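/- Let $R$ be a commutative ring with unit, let $I\subseteq R$ be the ideal generated by a finite regular sequence $r_1,\dots,r_n$, and let $s\ge 0$. Let $J=(x_1,\dots,x_n)\subseteq R[x_1,\dots,x_n]$, so that $J^s/J^{s+1}$ is the free $R$-module on the monomials of degree $s$. Let $Q^s$ be the complex with $Q^s_l=\Lambda^l_R(e_1,\dots,e_n)\otimes_R J^s/J^{s+1}$ and differential $$d(e_{i_1}\wedge\dots\wedge e_{i_l}\otimes f)=(-1)^s\sum_{j=1}^{l}(-1)^{j-1}\,r_{i_j}\; e_{i_1}\wedge\dots\wedge\widehat{e}_{i_j}\wedge\dots\wedge e_{i_l}\otimes f ,$$ with augmentation $\varepsilon^s\colon Q^s_0=J^s/J^{s+1}\to I^s/I^{s+1}$, $f\mapsto(-1)^{s(s+1)/2}\,f(r_1,\dots,r_n)$. Then $Q^s$ is an $R$-free resolution of $I^s/I^{s+1}$ via $\varepsilon^s$. Since the differentials of $R/I\otimes_R Q^s$ vanish, it gives identifications $$\operatorname{Tor}^R_l(R/I,I^s/I^{s+1})= R/I\otimes_R\Lambda^l_R(e_1,\dots,e_n)\otimes_R J^s/J^{s+1}\qquad(l\ge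 0).$$ Under these identifications, the connecting homomorphism $$\partial\colon \operatorname{Tor}^R_{*+1}(R/I,I^s/I^{s+1})\to \operatorname{Tor}^R_{*}(R/I,I^{s+1}/I^{s+2})$$ of the short exact sequence $0\to I^{s+1}/I^{s+2}\to I^s/I^{s+2}\to I^s/I^{s+1}\to 0$ (that is, the connecting homomorphism of the snake lemma for $R/I\otimes_R-$ applied to a short exact sequence of projective resolutions of the three modules) is given by $$\partial(e_{i_1}\wedge\dots\wedge e_{i_l}\otimes f)=\sum_{j=1}^{l}(-1)^{j+l}\; e_{i_1}\wedge\dots\wedge\widehat{e}_{i_j}\wedge\dots\wedge e_{i_l}\otimes x_{i_j}f$$ for all $l\ge 1$, all $i_1,\dots,i_l\in\{1,\dots,n\}$ and every monomial $f$ of degree $s$ in $x_1,\dots,x_n$, where the hat means that the entry is omitted. -/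

import Mathlib

open CategoryTheory CategoryTheory.Limits
open scoped TensorProduct

universe v u

namespace KoszulTor

section Abstract

variable {C : Type u} [Category.{v} C] [Abelian C]

/-- A short exact sequence `0 → P₁ → P₂ → P₃ → 0` of projective resolutions lying over the three-term
sequence `S`. -/
structure ResolutionSES (S : ShortComplex C) where
  P₁ : ProjectiveResolution S.X₁
  P₂ : ProjectiveResolution S.X₂
  P₃ : ProjectiveResolution S.X₃
  f : P₁.complex ⟶ P₂.complex
  g : P₂.complex ⟶ P₃.complex
  zero : f ≫ g = 0
  shortExact : (ShortComplex.mk f g zero).ShortExact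
  comm_f : f ≫ P₂.π = P₁.π ≫ (ChainComplex.single₀ C).map S.f
  comm_g : g ≫ P₃.π = P₂.π ≫ (ChainComplex.single₀ C).map S.g

namespace Horseshoe

/-- The augmentation of a projective resolution in degree zero. -/
noncomputable def aug {Z : C} (P : ProjectiveResolution Z) : P.complex.X 0 ⟶ Z := P.π.f 0

instance {Z : C} (P : ProjectiveResolution Z) : Epi (aug P) :=
  inferInstanceAs (Epi (P.π.f 0))

@[simp]
lemma d_aug {Z : C} (P : ProjectiveResolution Z) : P.complex.d 1 0 ≫ aug P = 0 :=
  P.complex_d_comp_π_f_zero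

@[simp]
lemma d_aug_assoc {Z Y : C} (P : ProjectiveResolution Z) (h : Z ⟶ Y) :
    P.complex.d 1 0 ≫ aug P ≫ h = 0 := by
  rw [← Category.assoc, d_aug, zero_comp]

lemma exact_aug {Z : C} (P : ProjectiveResolution Z) :
    (ShortComplex.mk _ _ (d_aug P)).Exact := P.exact₀

variable {S : ShortComplex C}
  (P₁ : ProjectiveResolution S.X₁) (P₃ : ProjectiveResolution S.X₃)

/-- First step of the horseshoe lemma. -/
lemma exists_start (hS : S.ShortExact) : ∃ (lam : P₃.complex.X 0 ⟶ S.X₂) (θ : P₃.complex.X 1 ⟶ P₁.complex.X 0),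
    lam ≫ S.g = aug P₃ ∧ (θ ≫ aug P₁) ≫ S.f + P₃.complex.d 1 0 ≫ lam = 0 := by
  have := hS.epi_g
  have := hS.mono_f
  let lam : P₃.complex.X 0 ⟶ S.X₂ := Projective.factorThru (aug P₃) S.g
  have hlam : lam ≫ S.g = aug P₃ := Projective.factorThru_comp _ _
  let μ : P₃.complex.X 1 ⟶ S.X₁ := hS.exact.lift (- P₃.complex.d 1 0 ≫ lam) (by
    simp [hlam])
  have hμ : μ ≫ S.f = - P₃.complex.d 1 0 ≫ lam := hS.exact.lift_f _ _
  let θ : P₃.complex.X 1 ⟶ P₁.complex.X 0 := Projective.factorThru (P := P₃.complex.X 1) μ (aug P₁)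
  have hθ : θ ≫ aug P₁ = μ := Projective.factorThru_comp _ _
  refine ⟨lam, θ, hlam, ?_⟩
  rw [hθ, hμ]; simp

/-- The components `P₃ₙ₊₁ → P₁ₙ` of the twisting map that can be continued one step further. -/
abbrev State (n : ℕ) : Type v :=
  { θ : P₃.complex.X (n + 1) ⟶ P₁.complex.X n //
    ∃ t : P₃.complex.X (n + 2) ⟶ P₁.complex.X (n + 1),
      t ≫ P₁.complex.d (n + 1) n = - P₃.complex.d (n + 2) (n + 1) ≫ θ }

/-- The next component of the twisting map. -/
noncomputable def next (n : ℕ) (θ : State P₁ P₃ n) : State P₁ P₃ (n + 1) :=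
  ⟨θ.2.choose, by
    have h := θ.2.choose_spec
    refine ⟨(P₁.exact_succ n).liftFromProjective
      (- P₃.complex.d (n + 3) (n + 2) ≫ θ.2.choose) ?_, ?_⟩
    · simp [h]
    · exact (P₁.exact_succ n).liftFromProjective_comp _ _⟩

lemma exists_twist (hS : S.ShortExact) : ∃ (lam : P₃.complex.X 0 ⟶ S.X₂)
    (θ : ∀ i j, P₃.complex.X i ⟶ P₁.complex.X j),
    lam ≫ S.g = aug P₃ ∧ (θ 1 0 ≫ aug P₁) ≫ S.f + P₃.complex.d 1 0 ≫ lam = 0 ∧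
    (∀ i j, ¬ (ComplexShape.down ℕ).Rel i j → θ i j = 0) ∧
    (∀ i j k, θ i j ≫ P₁.complex.d j k + P₃.complex.d i j ≫ θ j k = 0) := by
  have := hS.mono_f
  obtain ⟨lam, θ₀, h₁, h₂⟩ := exists_start P₁ P₃ hS
  have h₃ : ∃ t : P₃.complex.X 2 ⟶ P₁.complex.X 1,
      t ≫ P₁.complex.d 1 0 = - P₃.complex.d 2 1 ≫ θ₀ := by
    refine ⟨(exact_aug P₁).liftFromProjective (- P₃.complex.d 2 1 ≫ θ₀) ?_,
      (exact_aug P₁).liftFromProjective_comp _ _⟩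
    show (- P₃.complex.d 2 1 ≫ θ₀) ≫ aug P₁ = 0
    rw [← cancel_mono S.f]
    have : (θ₀ ≫ aug P₁) ≫ S.f = - P₃.complex.d 1 0 ≫ lam := by
      rw [eq_neg_iff_add_eq_zero, h₂]
    simp only [Category.assoc] at this
    simp [this]
  let st : ∀ n, State P₁ P₃ n := fun n => Nat.rec ⟨θ₀, h₃⟩ (fun n s => next P₁ P₃ n s) n
  have hst : ∀ n, (st (n + 1)).1 ≫ P₁.complex.d (n + 1) n =
      - P₃.complex.d (n + 2) (n + 1) ≫ (st n).1 := fun n => (st n).2.choose_spec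
  let θ : ∀ i j, P₃.complex.X i ⟶ P₁.complex.X j := fun i j =>
    if h : i = j + 1 then eqToHom (by rw [h]) ≫ (st j).1 else 0
  have hθ : ∀ j, θ (j + 1) j = (st j).1 := fun j => by simp [θ]
  have hθ0 : ∀ i j, ¬ (ComplexShape.down ℕ).Rel i j → θ i j = 0 := fun i j h => by
    have : ¬ i = j + 1 := fun h' => h (by simp [h'])
    simp [θ, this]
  refine ⟨lam, θ, h₁, ?_, hθ0, ?_⟩
  · rw [hθ 0]; exact h₂
  · intro i j k
    by_cases hij : (ComplexShape.down ℕ).Rel i j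
    · by_cases hjk : (ComplexShape.down ℕ).Rel j k
      · obtain rfl : j + 1 = i := hij
        obtain rfl : k + 1 = j := hjk
        rw [hθ, hθ, hst]; simp
      · rw [hθ0 j k hjk, P₁.complex.shape j k hjk]; simp
    · rw [hθ0 i j hij, P₃.complex.shape i j hij]; simp

/-- The middle complex `P₁ ⊞ P₃` with differential twisted by `θ`. -/
@[simps]
noncomputable def middle (θ : ∀ i j, P₃.complex.X i ⟶ P₁.complex.X j)
    (h₀ : ∀ i j, ¬ (ComplexShape.down ℕ).Rel i j → θ i j = 0)
    (h : ∀ i j k, θ i j ≫ P₁.complex.d j k + P₃.complex.d i j ≫ θ j k = 0) :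
    ChainComplex C ℕ where
  X n := P₁.complex.X n ⊞ P₃.complex.X n
  d i j := biprod.desc (P₁.complex.d i j ≫ biprod.inl)
    (θ i j ≫ biprod.inl + P₃.complex.d i j ≫ biprod.inr)
  shape i j hij := by
    rw [h₀ i j hij, P₁.complex.shape i j hij, P₃.complex.shape i j hij]
    ext <;> simp
  d_comp_d' i j k _ _ := by
    ext
    · simp
    · simp
    · simpa using h i j k
    · simp

end Horseshoe

lemma isZero_homology_succ {Z : C} (P : ProjectiveResolution Z) (n : ℕ) :
    IsZero (P.complex.homology (n + 1)) :=
  (P.complex_exactAt_succ n).isZero_homology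

lemma shortExact_homology {T : ShortComplex (ChainComplex C ℕ)} (hT : T.ShortExact)
    (h₃ : ∀ n, T.X₃.ExactAt (n + 1)) (n : ℕ) :
    (T.map (HomologicalComplex.homologyFunctor C _ n)).ShortExact where
  exact := hT.homology_exact₂ n
  mono_f := by
    have := (hT.homology_exact₁ (n + 1) n (by simp))
    exact this.mono_g ((h₃ n).isZero_homology.eq_of_src _ _)
  epi_g := by
    cases n with
    | zero =>
      have := hT.epi_g
      have h1 : Epi (HomologicalComplex.opcyclesMap T.g 0) := inferInstance
      have h2 := ChainComplex.isoHomologyι₀_inv_naturality T.g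
      have : HomologicalComplex.homologyMap T.g 0 =
        T.X₂.isoHomologyι₀.hom ≫ HomologicalComplex.opcyclesMap T.g 0 ≫ T.X₃.isoHomologyι₀.inv := by
        rw [← h2, Iso.hom_inv_id_assoc]
      change Epi (HomologicalComplex.homologyMap T.g 0)
      rw [this]
      infer_instance
    | succ m => exact (h₃ m).isZero_homology.epi _

lemma quasiIso_τ₂ {T T' : ShortComplex (ChainComplex C ℕ)} (hT : T.ShortExact)
    (hT' : T'.ShortExact) (h₃ : ∀ n, T.X₃.ExactAt (n + 1)) (h₃' : ∀ n, T'.X₃.ExactAt (n + 1))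
    (φ : T ⟶ T') (h₁ : QuasiIso φ.τ₁) (h₂ : QuasiIso φ.τ₃) : QuasiIso φ.τ₂ where
  quasiIsoAt n := by
    rw [quasiIsoAt_iff_isIso_homologyMap]
    let ψ := (HomologicalComplex.homologyFunctor C (ComplexShape.down ℕ) n).mapShortComplex.map φ
    have i1 : IsIso ψ.τ₁ := inferInstanceAs (IsIso (HomologicalComplex.homologyMap φ.τ₁ n))
    have i3 : IsIso ψ.τ₃ := inferInstanceAs (IsIso (HomologicalComplex.homologyMap φ.τ₃ n))
    exact ShortComplex.isIso₂_of_shortExact_of_isIso₁₃ ψ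
      (shortExact_homology hT h₃ n) (shortExact_homology hT' h₃' n)

/-- The horseshoe lemma: a short exact sequence has a short exact sequence of projective
resolutions. -/
theorem ResolutionSES.nonempty {S : ShortComplex C} (hS : S.ShortExact)
    (P₁ : ProjectiveResolution S.X₁) (P₃ : ProjectiveResolution S.X₃) :
    Nonempty (ResolutionSES S) := by
  obtain ⟨lam, θ, h₁, h₂, h₀, h⟩ := Horseshoe.exists_twist P₁ P₃ hS
  let M := Horseshoe.middle P₁ P₃ θ h₀ h
  let f : P₁.complex ⟶ M :=
    { f := fun n => biprod.inl
      comm' := by intros; simp only [M, Horseshoe.middle]; simp }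
  let g : M ⟶ P₃.complex :=
    { f := fun n => biprod.snd
      comm' := by intros; simp only [M, Horseshoe.middle]; ext <;> simp }
  have zero : f ≫ g = 0 := by ext n; exact biprod.inl_snd
  have hT : (ShortComplex.mk f g zero).ShortExact := by
    apply HomologicalComplex.shortExact_of_degreewise_shortExact
    intro n
    exact (ShortComplex.Splitting.ofHasBinaryBiproduct
      (P₁.complex.X n) (P₃.complex.X n)).shortExact
  have hd : (biprod.desc (P₁.complex.d 1 0 ≫ biprod.inl)
      (θ 1 0 ≫ biprod.inl + P₃.complex.d 1 0 ≫ biprod.inr) :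
        P₁.complex.X 1 ⊞ P₃.complex.X 1 ⟶ P₁.complex.X 0 ⊞ P₃.complex.X 0) ≫
      biprod.desc (Horseshoe.aug P₁ ≫ S.f) lam = 0 := by
    apply biprod.hom_ext'
    · simp [Horseshoe.d_aug_assoc]
    · simpa using h₂
  let π : M ⟶ (ChainComplex.single₀ C).obj S.X₂ :=
    (ChainComplex.toSingle₀Equiv M S.X₂).symm ⟨biprod.desc (Horseshoe.aug P₁ ≫ S.f) lam, hd⟩
  have hπ : π.f 0 = biprod.desc (Horseshoe.aug P₁ ≫ S.f) lam :=
    ChainComplex.toSingle₀Equiv_symm_apply_f_zero _ _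
  have comm_f : f ≫ π = P₁.π ≫ (ChainComplex.single₀ C).map S.f := by
    apply HomologicalComplex.to_single_hom_ext
    rw [HomologicalComplex.comp_f, HomologicalComplex.comp_f, hπ,
      ChainComplex.single₀_map_f_zero]
    exact biprod.inl_desc _ _
  have comm_g : g ≫ P₃.π = π ≫ (ChainComplex.single₀ C).map S.g := by
    apply HomologicalComplex.to_single_hom_ext
    rw [HomologicalComplex.comp_f, HomologicalComplex.comp_f, hπ,
      ChainComplex.single₀_map_f_zero]
    change biprod.snd ≫ Horseshoe.aug P₃ = biprod.desc (Horseshoe.aug P₁ ≫ S.f) lam ≫ S.g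
    apply biprod.hom_ext'
    · simp
    · simp [h₁]
  have hS' : (S.map (ChainComplex.single₀ C)).ShortExact := by
    exact hS.map_of_exact _
  have hq : QuasiIso π := quasiIso_τ₂ hT hS' P₃.complex_exactAt_succ
    (fun n => HomologicalComplex.exactAt_single_obj _ _ _ _ (by simp))
    (ShortComplex.Hom.mk P₁.π π P₃.π comm_f.symm comm_g.symm) P₁.quasiIso P₃.quasiIso
  exact ⟨⟨P₁, ⟨M, fun n => inferInstanceAs (Projective (P₁.complex.X n ⊞ P₃.complex.X n)), π, hq⟩,
    P₃, f, g, zero, hT, comm_f, comm_g⟩⟩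

/-- An additive functor keeps a short exact sequence of projective resolutions short exact. -/
theorem ResolutionSES.shortExact_map {S : ShortComplex C} (D : ResolutionSES S)
    {E : Type*} [Category* E] [Abelian E] (F : C ⥤ E) [F.Additive] :
    ((ShortComplex.mk D.f D.g D.zero).map
      (F.mapHomologicalComplex (ComplexShape.down ℕ))).ShortExact := by
  apply HomologicalComplex.shortExact_of_degreewise_shortExact
  intro n
  have h := D.shortExact.map_of_exact (HomologicalComplex.eval C (ComplexShape.down ℕ) n)
  have : Projective ((ShortComplex.mk D.f D.g D.zero).map
      (HomologicalComplex.eval C (ComplexShape.down ℕ) n)).X₃ := D.P₃.projective n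
  exact (h.splittingOfProjective.map F).shortExact

/-- The connecting homomorphism `Lₙ₊₁F(S.X₃) → LₙF(S.X₁)`: apply `F` to a short exact sequence of
projective resolutions and take the connecting homomorphism of the snake lemma. -/
noncomputable def ResolutionSES.δ {S : ShortComplex C} (D : ResolutionSES S)
    {E : Type*} [Category* E] [Abelian E] (F : C ⥤ E) [F.Additive] [HasProjectiveResolutions C] (n : ℕ) :
    (F.leftDerived (n + 1)).obj S.X₃ ⟶ (F.leftDerived n).obj S.X₁ :=
  (D.P₃.isoLeftDerivedObj F (n + 1)).hom ≫
    (D.shortExact_map F).δ (n + 1) n rfl ≫ (D.P₁.isoLeftDerivedObj F n).inv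

/-- The connecting homomorphism of the left derived functors of `F` attached to a short exact
sequence. -/
noncomputable def leftDerivedδ [HasProjectiveResolutions C] {E : Type*} [Category* E] [Abelian E]
    (F : C ⥤ E) [F.Additive] {S : ShortComplex C} (hS : S.ShortExact) (n : ℕ) :
    (F.leftDerived (n + 1)).obj S.X₃ ⟶ (F.leftDerived n).obj S.X₁ :=
  (Classical.choice (ResolutionSES.nonempty hS (projectiveResolution S.X₁)
    (projectiveResolution S.X₃))).δ F n

end Abstract

section Koszul
variable {R : Type u} [CommRing R] {n : ℕ}

/-- Contraction with a functional lowers the exterior degree by one. -/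
lemma contractLeft_mem {M : Type*} [AddCommGroup M] [Module R M] (φ : Module.Dual R M) (l : ℕ)
    {x : ExteriorAlgebra R M} (hx : x ∈ ⋀[R]^(l + 1) M) :
    (CliffordAlgebra.contractLeft (Q := (0 : QuadraticForm R M)) φ x : ExteriorAlgebra R M)
      ∈ ⋀[R]^l M := by
  induction l generalizing x with
  | zero =>
    change x ∈ (LinearMap.range (ExteriorAlgebra.ι R : M →ₗ[R] _)) ^ (0 + 1) at hx
    rw [zero_add, pow_one] at hx
    obtain ⟨m, rfl⟩ := hx
    change _ ∈ (LinearMap.range (ExteriorAlgebra.ι R : M →ₗ[R] _)) ^ 0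
    rw [pow_zero]
    erw [CliffordAlgebra.contractLeft_ι]
    exact Submodule.algebraMap_mem _
  | succ l ih =>
    change x ∈ (LinearMap.range (ExteriorAlgebra.ι R : M →ₗ[R] _)) ^ (l + 1 + 1) at hx
    rw [pow_succ'] at hx
    induction hx using Submodule.mul_induction_on' with
    | mem_mul_mem a ha b hb =>
      obtain ⟨m, rfl⟩ := ha
      erw [CliffordAlgebra.contractLeft_ι_mul]
      refine Submodule.sub_mem _ (Submodule.smul_mem _ _ hb) ?_
      change _ ∈ (LinearMap.range (ExteriorAlgebra.ι R : M →ₗ[R] _)) ^ (l + 1)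
      rw [pow_succ']
      exact Submodule.mul_mem_mul (LinearMap.mem_range_self _ _) (ih hb)
    | add a _ b _ ha hb => rw [map_add]; exact Submodule.add_mem _ ha hb

/-- Contraction `v₁ ∧ … ∧ vₗ₊₁ ↦ ∑ (-1)^(j-1) φ(vⱼ) v₁ ∧ … v̂ⱼ … ∧ vₗ₊₁`. -/
noncomputable def contr {M : Type*} [AddCommGroup M] [Module R M] (φ : Module.Dual R M) (l : ℕ) :
    ⋀[R]^(l + 1) M →ₗ[R] ⋀[R]^l M :=
  (CliffordAlgebra.contractLeft (Q := (0 : QuadraticForm R M)) φ).restrict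
    fun _ hx => contractLeft_mem φ l hx

lemma contr_comp {M : Type*} [AddCommGroup M] [Module R M] (φ : Module.Dual R M) (l : ℕ) :
    contr φ l ∘ₗ contr φ (l + 1) = 0 := by
  refine LinearMap.ext fun x => Subtype.ext ?_
  exact CliffordAlgebra.contractLeft_contractLeft φ (x : ExteriorAlgebra R M)

lemma contr_sum {M ι : Type*} [AddCommGroup M] [Module R M] [Fintype ι] (c : ι → R)
    (φ : ι → Module.Dual R M) (l : ℕ) :
    contr (∑ i, c i • φ i) l = ∑ i, c i • contr (φ i) l := by
  refine LinearMap.ext fun x => Subtype.ext ?_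
  simp [contr, LinearMap.sum_apply]

/-- The ideal `I = (r₁, …, rₙ)`. -/
def seqIdeal (r : Fin n → R) : Ideal R := Ideal.span (Set.range r)

/-- The free `R`-module on the monomials of degree `s` in `x₁, …, xₙ`; it is `J^s / J^(s+1)` for
`J = (x₁, …, xₙ) ⊆ R[x₁, …, xₙ]`. -/
abbrev Forms (R : Type u) [CommRing R] (n s : ℕ) : Type u := MvPolynomial.homogeneousSubmodule (Fin n) R s

/-- The degree `l` part of the exterior algebra `Λ(e₁, …, eₙ)`. -/
abbrev ExtPow (R : Type u) [CommRing R] (n l : ℕ) : Type u := ⋀[R]^l (Fin n → R)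

/-- The differential of the Koszul complex `K = Λ(e₁, …, eₙ)`, the derivation with `d(eᵢ) = rᵢ`. -/
noncomputable def koszulD (r : Fin n → R) (l : ℕ) : ExtPow R n (l + 1) →ₗ[R] ExtPow R n l :=
  contr (∑ i, r i • (LinearMap.proj i : (Fin n → R) →ₗ[R] R)) l

/-- The vertical differential of the extended Koszul double complex in column `s` (position `-s`),
with the sign `(-1)^s` that it carries in the total complex. -/
noncomputable def colD (r : Fin n → R) (s l : ℕ) :
    ExtPow R n (l + 1) ⊗[R] Forms R n s →ₗ[R] ExtPow R n l ⊗[R] Forms R n s :=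
  (-1 : R) ^ s • LinearMap.rTensor (Forms R n s) (koszulD r l)

/-- The complex `Σ⁻ˢ(K ⊗ J^s/J^(s+1))`: column `s` of the extended Koszul double complex, where
`e_{i₁} ∧ … ∧ e_{iₗ} ⊗ f` has total degree `l`. -/
noncomputable def column (r : Fin n → R) (s : ℕ) : ChainComplex (ModuleCat.{u} R) ℕ :=
  ChainComplex.of (fun l => ModuleCat.of R (ExtPow R n l ⊗[R] Forms R n s))
    (fun l => ModuleCat.ofHom (colD r s l)) (by
      intro l
      rw [← ModuleCat.ofHom_comp]
      have : colD r s l ∘ₗ colD r s (l + 1) = 0 := by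
        simp only [colD, LinearMap.comp_smul, LinearMap.smul_comp, ← LinearMap.rTensor_comp,
          koszulD, contr_comp, LinearMap.rTensor_zero, smul_zero]
      rw [this]; rfl)

lemma column_d (r : Fin n → R) (s l : ℕ) :
    (column r s).d (l + 1) l = ModuleCat.ofHom (colD r s l) :=
  ChainComplex.of_d (fun l => ModuleCat.of R (ExtPow R n l ⊗[R] Forms R n s))
    (fun l => ModuleCat.ofHom (colD r s l)) l

/-- The `R`-module `I^s / I^t` (used for `s ≤ t`). -/
abbrev PowQuot (I : Ideal R) (s t : ℕ) : Type u := ↥(I ^ s) ⧸ (I ^ t).submoduleOf (I ^ s)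

/-- The inclusion `I^(s+1)/I^(s+2) → I^s/I^(s+2)`. -/
noncomputable def powQuotIncl (I : Ideal R) (s : ℕ) :
    PowQuot I (s + 1) (s + 2) →ₗ[R] PowQuot I s (s + 2) :=
  Submodule.mapQ _ _ (Submodule.inclusion (Ideal.pow_le_pow_right (Nat.le_succ s))) (by
    intro x hx; exact hx)

/-- The projection `I^s/I^(s+2) → I^s/I^(s+1)`. -/
noncomputable def powQuotProj (I : Ideal R) (s : ℕ) :
    PowQuot I s (s + 2) →ₗ[R] PowQuot I s (s + 1) :=
  Submodule.mapQ _ _ LinearMap.id (by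
    intro x hx; exact Ideal.pow_le_pow_right (Nat.le_succ (s + 1)) hx)

lemma powQuotProj_comp_incl (I : Ideal R) (s : ℕ) : powQuotProj I s ∘ₗ powQuotIncl I s = 0 := by
  refine LinearMap.ext fun x => ?_
  obtain ⟨x, rfl⟩ := Submodule.Quotient.mk_surjective _ x
  exact (Submodule.Quotient.mk_eq_zero _).2 x.2

lemma powQuotIncl_injective (I : Ideal R) (s : ℕ) : Function.Injective (powQuotIncl I s) := by
  intro x y h
  obtain ⟨x, rfl⟩ := Submodule.Quotient.mk_surjective _ x
  obtain ⟨y, rfl⟩ := Submodule.Quotient.mk_surjective _ y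
  have h' := (Submodule.Quotient.eq _).1 h
  exact (Submodule.Quotient.eq _).2 h'

lemma powQuotProj_surjective (I : Ideal R) (s : ℕ) : Function.Surjective (powQuotProj I s) := by
  intro x
  obtain ⟨x, rfl⟩ := Submodule.Quotient.mk_surjective _ x
  exact ⟨Submodule.Quotient.mk x, rfl⟩

lemma powQuot_exact (I : Ideal R) (s : ℕ) (x : PowQuot I s (s + 2)) (hx : powQuotProj I s x = 0) :
    ∃ y, powQuotIncl I s y = x := by
  obtain ⟨x, rfl⟩ := Submodule.Quotient.mk_surjective _ x
  have hx' : (x : R) ∈ I ^ (s + 1) := by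
    have h := (Submodule.Quotient.mk_eq_zero _).1 hx
    exact h
  exact ⟨Submodule.Quotient.mk ⟨x, hx'⟩, rfl⟩

/-- The sequence `0 → I^(s+1)/I^(s+2) → I^s/I^(s+2) → I^s/I^(s+1) → 0`. -/
noncomputable def powSES (I : Ideal R) (s : ℕ) : ShortComplex (ModuleCat.{u} R) :=
  ShortComplex.mk (ModuleCat.ofHom (powQuotIncl I s)) (ModuleCat.ofHom (powQuotProj I s)) (by
    rw [← ModuleCat.ofHom_comp, powQuotProj_comp_incl]; rfl)

lemma powSES_shortExact (I : Ideal R) (s : ℕ) : (powSES I s).ShortExact where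
  exact := (ShortComplex.moduleCat_exact_iff _).2 (powQuot_exact I s)
  mono_f := (ModuleCat.mono_iff_injective _).2 (powQuotIncl_injective I s)
  epi_g := (ModuleCat.epi_iff_surjective _).2 (powQuotProj_surjective I s)

lemma eval_mem (r : Fin n → R) {s : ℕ} {f : MvPolynomial (Fin n) R} (hf : f.IsHomogeneous s) :
    MvPolynomial.eval r f ∈ seqIdeal r ^ s := by
  have hI : (MvPolynomial.idealOfVars (Fin n) R).map (MvPolynomial.eval r) ≤ seqIdeal r := by
    rw [MvPolynomial.idealOfVars, Ideal.map_span, Ideal.span_le]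
    rintro _ ⟨_, ⟨i, rfl⟩, rfl⟩
    rw [SetLike.mem_coe, MvPolynomial.eval_X]
    exact Ideal.subset_span (Set.mem_range_self i)
  have hf' : f ∈ MvPolynomial.idealOfVars (Fin n) R ^ s := by
    rw [MvPolynomial.mem_pow_idealOfVars_iff]
    intro m hm
    rw [Finsupp.degree_eq_weight_one]
    exact (hf (MvPolynomial.mem_support_iff.1 hm)).ge
  have := Ideal.mem_map_of_mem (MvPolynomial.eval r) hf'
  rw [Ideal.map_pow] at this
  exact Ideal.pow_right_mono hI s this

/-- The map `J^s/J^(s+1) → I^s/I^(s+1)` that sends `f` to the class of `f(r₁, …, rₙ)`. -/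
noncomputable def evalForms (r : Fin n → R) (s : ℕ) :
    Forms R n s →ₗ[R] PowQuot (seqIdeal r) s (s + 1) :=
  Submodule.mkQ _ ∘ₗ
    ((MvPolynomial.aeval r).toLinearMap.restrict
      (p := MvPolynomial.homogeneousSubmodule (Fin n) R s) (q := seqIdeal r ^ s)
      fun f hf => by
        rw [AlgHom.toLinearMap_apply, MvPolynomial.aeval_eq_eval]
        exact eval_mem r hf)

/-- The augmentation `f ↦ (-1)^(s(s+1)/2) f(r₁, …, rₙ)` in degree zero. The sign is the one for which
the augmentations of the columns `s` and `s + 1` together vanish on the total boundaries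
`d(eⱼ ⊗ f) = xⱼ f + (-1)^s rⱼ f` (`f` of degree `s`). -/
noncomputable def augLin (r : Fin n → R) (s : ℕ) :
    ExtPow R n 0 ⊗[R] Forms R n s →ₗ[R] PowQuot (seqIdeal r) s (s + 1) :=
  (-1 : R) ^ (s * (s + 1) / 2) • (LinearMap.lsmul R (PowQuot (seqIdeal r) s (s + 1))
    |>.compl₁₂ (exteriorPower.zeroEquiv R (Fin n → R)).toLinearMap (evalForms r s) |> TensorProduct.lift)

lemma koszulD_eq (r : Fin n → R) (l : ℕ) : koszulD r l =
    ∑ i, r i • contr (LinearMap.proj i : (Fin n → R) →ₗ[R] R) l := contr_sum _ _ _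

lemma mem_seqIdeal (r : Fin n → R) (i : Fin n) : r i ∈ seqIdeal r :=
  Ideal.subset_span (Set.mem_range_self i)

lemma augLin_comp_colD (r : Fin n → R) (s : ℕ) : augLin r s ∘ₗ colD r s 0 = 0 := by
  have h : ∀ (i : Fin n) (x : PowQuot (seqIdeal r) s (s + 1)), r i • x = 0 := by
    intro i x
    obtain ⟨x, rfl⟩ := Submodule.Quotient.mk_surjective _ x
    refine (Submodule.Quotient.mk_eq_zero _).2 ?_
    change r i * (x : R) ∈ seqIdeal r ^ (s + 1)
    rw [pow_succ']
    exact Ideal.mul_mem_mul (mem_seqIdeal r i) x.2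
  apply TensorProduct.ext'
  intro ω f
  simp only [colD, koszulD_eq, LinearMap.comp_apply, LinearMap.smul_apply, LinearMap.rTensor_tmul,
    LinearMap.sum_apply, TensorProduct.sum_tmul, map_smul, map_sum, ← TensorProduct.smul_tmul', h]
  simp

/-- The augmentation of `column r s` onto `I^s/I^(s+1)`. -/
noncomputable def columnAug (r : Fin n → R) (s : ℕ) :
    column r s ⟶ (ChainComplex.single₀ (ModuleCat.{u} R)).obj
      (ModuleCat.of R (PowQuot (seqIdeal r) s (s + 1))) :=
  (ChainComplex.toSingle₀Equiv _ _).symm ⟨ModuleCat.ofHom (augLin r s), by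
    rw [column_d]
    exact congrArg ModuleCat.ofHom (augLin_comp_colD r s)⟩

instance projective_forms (s : ℕ) : Module.Projective R (Forms R n s) :=
  Module.Projective.of_split (MvPolynomial.homogeneousSubmodule (Fin n) R s).subtype
    ((MvPolynomial.homogeneousComponent s).codRestrict _
      (MvPolynomial.homogeneousComponent_mem s)) (by
    refine LinearMap.ext fun f => Subtype.ext ?_
    simpa using MvPolynomial.homogeneousComponent_of_mem (m := s) (n := s) f.2)

instance projective_column (r : Fin n → R) (s l : ℕ) : Projective ((column r s).X l) :=
  inferInstanceAs (Projective (ModuleCat.of R (ExtPow R n l ⊗[R] Forms R n s)))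

/-- `column r s` as a projective resolution of `I^s/I^(s+1)`, once its augmentation is known to be a
quasi-isomorphism. -/
noncomputable def columnResolution (r : Fin n → R) (s : ℕ) (h : QuasiIso (columnAug r s)) :
    ProjectiveResolution (ModuleCat.of R (PowQuot (seqIdeal r) s (s + 1))) where
  complex := column r s
  π := columnAug r s

/-- Tensoring the column with `R/I` kills the differentials. -/
lemma tensor_column_d (r : Fin n → R) (s i j : ℕ) :
    (((MonoidalCategory.tensoringLeft (ModuleCat.{u} R)).obj (ModuleCat.of R (R ⧸ seqIdeal r))).mapHomologicalComplex
      (ComplexShape.down ℕ) |>.obj (column r s)).d i j = 0 := by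
  by_cases hij : (ComplexShape.down ℕ).Rel i j
  swap
  · exact HomologicalComplex.shape _ _ _ hij
  obtain rfl : j + 1 = i := hij
  have h : LinearMap.lTensor (R ⧸ seqIdeal r) (colD r s j) = 0 := by
    have h' : ∀ (i : Fin n) (a : R ⧸ seqIdeal r), r i • a = 0 := by
      intro i a
      obtain ⟨a, rfl⟩ := Ideal.Quotient.mk_surjective a
      exact Ideal.Quotient.eq_zero_iff_mem.2 (Ideal.mul_mem_right _ _ (mem_seqIdeal r i))
    refine TensorProduct.ext_threefold' fun a ω f => ?_
    have h'' : ∀ (i : Fin n) (z : ExtPow R n j ⊗[R] Forms R n s), r i • (a ⊗ₜ[R] z) = 0 := by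
      intro i z
      rw [TensorProduct.smul_tmul', h', TensorProduct.zero_tmul]
    simp [colD, koszulD_eq, TensorProduct.sum_tmul, TensorProduct.tmul_sum,
      ← TensorProduct.smul_tmul', h'']
  rw [Functor.mapHomologicalComplex_obj_d, column_d]
  exact congrArg ModuleCat.ofHom h


/-- As all its differentials vanish, the complex `R/I ⊗ column r s` is its own homology. -/
noncomputable def tensorColumnHomologyIso (r : Fin n → R) (s l : ℕ) :
    ModuleCat.of R ((R ⧸ seqIdeal r) ⊗[R] (ExtPow R n l ⊗[R] Forms R n s)) ≅
      (((MonoidalCategory.tensoringLeft (ModuleCat.{u} R)).obj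
        (ModuleCat.of R (R ⧸ seqIdeal r))).mapHomologicalComplex
          (ComplexShape.down ℕ) |>.obj (column r s)).homology l :=
  (ShortComplex.HomologyData.ofZeros
    ((((MonoidalCategory.tensoringLeft (ModuleCat.{u} R)).obj
      (ModuleCat.of R (R ⧸ seqIdeal r))).mapHomologicalComplex
        (ComplexShape.down ℕ) |>.obj (column r s)).sc l)
    (tensor_column_d r s _ _) (tensor_column_d r s _ _)).left.homologyIso.symm

/-- `Tor_l(R/I, I^s/I^t)`. -/
noncomputable abbrev TorPow (I : Ideal R) (s t l : ℕ) : ModuleCat.{u} R :=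
  ((Tor (ModuleCat.{u} R) l).obj (ModuleCat.of R (R ⧸ I))).obj (ModuleCat.of R (PowQuot I s t))

/-- The identification `R/I ⊗ Λˡ(e₁, …, eₙ) ⊗ J^s/J^(s+1) ≃ Tor_l(R/I, I^s/I^(s+1))` given by
the resolution `column r s` of `I^s/I^(s+1)`. -/
noncomputable def torIso (r : Fin n → R) (s l : ℕ) (h : QuasiIso (columnAug r s)) :
    ((R ⧸ seqIdeal r) ⊗[R] (ExtPow R n l ⊗[R] Forms R n s)) ≃ₗ[R]
      TorPow (seqIdeal r) s (s + 1) l :=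
  (tensorColumnHomologyIso r s l ≪≫
    ((columnResolution r s h).isoLeftDerivedObj
      ((MonoidalCategory.tensoringLeft (ModuleCat.{u} R)).obj
        (ModuleCat.of R (R ⧸ seqIdeal r))) l).symm).toLinearEquiv

/-- The connecting homomorphism `∂ : Tor_{l+1}(R/I, I^s/I^(s+1)) → Tor_l(R/I, I^(s+1)/I^(s+2))` of
`0 → I^(s+1)/I^(s+2) → I^s/I^(s+2) → I^s/I^(s+1) → 0`. -/
noncomputable def torδ (I : Ideal R) (s l : ℕ) :
    TorPow I s (s + 1) (l + 1) →ₗ[R] TorPow I (s + 1) (s + 2) l :=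
  (leftDerivedδ ((MonoidalCategory.tensoringLeft (ModuleCat.{u} R)).obj
    (ModuleCat.of R (R ⧸ I))) (powSES_shortExact I s) l).hom

/-- The monomial `x₁^(m 1) ⋯ xₙ^(m n)` of degree `s`. -/
noncomputable def monomialForm (R : Type u) [CommRing R] {n s : ℕ} (m : Fin n →₀ ℕ)
    (hm : m.degree = s) : Forms R n s :=
  ⟨MvPolynomial.monomial m 1, MvPolynomial.isHomogeneous_monomial 1 hm⟩

/-- The product `xᵢ f`. -/
noncomputable def mulX {s : ℕ} (i : Fin n) (f : Forms R n s) : Forms R n (s + 1) :=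
  ⟨MvPolynomial.X i * f.1, by
    rw [add_comm]; exact (MvPolynomial.isHomogeneous_X R i).mul f.2⟩

/-- The element `e_{i₁} ∧ … ∧ e_{iₗ} ⊗ f` of `R/I ⊗ Λˡ(e₁, …, eₙ) ⊗ J^s/J^(s+1)`. -/
noncomputable def wedgeForm (r : Fin n → R) {s l : ℕ} (i : Fin l → Fin n) (f : Forms R n s) :
    (R ⧸ seqIdeal r) ⊗[R] (ExtPow R n l ⊗[R] Forms R n s) :=
  1 ⊗ₜ[R] (exteriorPower.ιMulti R l (fun a => (Pi.single (i a) 1 : Fin n → R)) ⊗ₜ[R] f)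

end Koszul

end KoszulTor

/-! The columns `Q^s` and `Q^(s+1)` are neighbours in a double complex. The horizontal map θ(ω ⊗ f)
= (-1)^l ∑ᵢ (eᵢ^* ⌟ ω) ⊗ xᵢf (`twistLin`) anticommutes with the vertical Koszul differentials,
because contractions anticommute, and it is compatible with the signed augmentations. Twisting the
differential of `Q^(s+1) ⊞ Q^s` by θ therefore gives a complex over I^s/I^(s+2), and comparison of
homology with the outer terms shows that it is a resolution: an explicit horseshoe.

For this horseshoe the snake lemma is immediate after applying R/I ⊗ -. Lift an element of `Q^s` to
the second summand and differentiate. The entries of `r` act as zero on R/I, so only θ survives and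
∂ = R/I ⊗ θ (`Twist.liftCycles_δ`, `torδ_torIso`). On a wedge of basis vectors θ is the stated
alternating sum. Since ∂ is defined by an arbitrary choice of resolutions, independence of that
choice is also needed (`ResolutionSES.δ_eq`).

It remains to see that `Q^s` resolves I^s/I^(s+1). In positive degrees this is exactness of the
Koszul complex of a regular sequence, tensored with a flat module (`exists_koszul_primitive`). At
degree zero it is quasi-regularity: a form of degree s whose value at r lies in I^(s+1) has all its
coefficients in I (`coeff_mem_of_eval_mem`). -/

namespace KoszulTor
-- Independence of the connecting homomorphism from the resolutions
section Comparison

variable {C : Type u} [Category.{v} C] [Abelian C]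

/-- The terms of a short exact sequence of projective resolutions form split exact sequences. -/
lemma ResolutionSES.exists_retraction {S : ShortComplex C} (D : ResolutionSES S) (n : ℕ) :
    ∃ ρ : D.P₂.complex.X n ⟶ D.P₁.complex.X n, D.f.f n ≫ ρ = 𝟙 _ := by
  have h := D.shortExact.map_of_exact (HomologicalComplex.eval C (ComplexShape.down ℕ) n)
  have : Projective ((ShortComplex.mk D.f D.g D.zero).map
      (HomologicalComplex.eval C (ComplexShape.down ℕ) n)).X₃ := D.P₃.projective n
  exact ⟨h.splittingOfProjective.r, h.splittingOfProjective.f_r⟩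

/-- Two short exact sequences of projective resolutions of the same short exact sequence can be
compared. -/
lemma ResolutionSES.exists_hom {S : ShortComplex C} (D D' : ResolutionSES S) :
    ∃ (φ₁ : D.P₁.complex ⟶ D'.P₁.complex) (φ₂ : D.P₂.complex ⟶ D'.P₂.complex)
      (φ₃ : D.P₃.complex ⟶ D'.P₃.complex),
      D.f ≫ φ₂ = φ₁ ≫ D'.f ∧ D.g ≫ φ₃ = φ₂ ≫ D'.g ∧
      φ₁ ≫ D'.P₁.π = D.P₁.π ∧ φ₃ ≫ D'.P₃.π = D.P₃.π := by
  let φ₁ := ProjectiveResolution.lift (𝟙 S.X₁) D.P₁ D'.P₁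
  have h₁ : φ₁ ≫ D'.P₁.π = D.P₁.π := by
    simp [φ₁]
  let ψ := ProjectiveResolution.lift (𝟙 S.X₂) D.P₂ D'.P₂
  have hψ : ψ ≫ D'.P₂.π = D.P₂.π := by
    simp [ψ]
  choose ρ hρ using D.exists_retraction
  -- The independently chosen lifts `φ₁` and `ψ` make the left square commute only up to homotopy.
  -- The degreewise retractions `ρ` extend this homotopy to `P₂`; subtracting the resulting
  -- null-homotopic map from `ψ` makes the square commute strictly.
  let H : Homotopy (D.f ≫ ψ) (φ₁ ≫ D'.f) := ProjectiveResolution.liftHomotopy S.f _ _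
    (by rw [Category.assoc, hψ, D.comm_f])
    (by rw [Category.assoc, D'.comm_f, ← Category.assoc, h₁])
  let h : ∀ i j, D.P₂.complex.X i ⟶ D'.P₂.complex.X j := fun i j => ρ i ≫ H.hom i j
  have hf : D.f ≫ Homotopy.nullHomotopicMap h = D.f ≫ ψ - φ₁ ≫ D'.f := by
    rw [Homotopy.comp_nullHomotopicMap, eq_sub_iff_add_eq]
    ext n
    rw [H.comm n]
    simp [h, reassoc_of% hρ, Homotopy.nullHomotopicMap]
  let φ₂ := ψ - Homotopy.nullHomotopicMap h
  have h₂ : φ₂ ≫ D'.P₂.π = D.P₂.π := by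
    -- The correction does not affect the augmentation: in degree 0 both terms of the null-homotopic
    -- map contain a zero differential, since the target is concentrated in degree 0.
    have : Homotopy.nullHomotopicMap h ≫ D'.P₂.π = 0 := by
      apply HomologicalComplex.to_single_hom_ext
      rw [Homotopy.nullHomotopicMap_comp]
      simp [Homotopy.nullHomotopicMap, prevD, dNext]
      rfl
    rw [Preadditive.sub_comp, hψ, this, sub_zero]
  have hc₂ : D.f ≫ φ₂ = φ₁ ≫ D'.f := by
    rw [Preadditive.comp_sub, hf, sub_sub_cancel]
  have : Epi D.g := D.shortExact.epi_g
  let φ₃ : D.P₃.complex ⟶ D'.P₃.complex := D.shortExact.exact.desc (φ₂ ≫ D'.g) (by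
    change D.f ≫ φ₂ ≫ D'.g = 0
    rw [reassoc_of% hc₂, D'.zero, comp_zero])
  have hc₃ : D.g ≫ φ₃ = φ₂ ≫ D'.g := D.shortExact.exact.g_desc _ _
  refine ⟨φ₁, φ₂, φ₃, hc₂, hc₃, h₁, ?_⟩
  rw [← cancel_epi D.g, reassoc_of% hc₃, D'.comm_g, reassoc_of% h₂, D.comm_g]

lemma hom_comp_comp_inv_eq {E : Type*} [Category* E] {A A' B X Y Z : E}
    (a : X ≅ A) (b : Y ≅ B) (a' : X ≅ A') (b' : Y ≅ Z) {d : A ⟶ B} {d' : A' ⟶ Z} {m₁ : B ⟶ Z}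
    {m₃ : A ⟶ A'} (h : d ≫ m₁ = m₃ ≫ d') (h₁ : b.hom ≫ m₁ = b'.hom) (h₃ : a.hom ≫ m₃ = a'.hom) :
    a.hom ≫ d ≫ b.inv = a'.hom ≫ d' ≫ b'.inv := by
  have hb : b.inv = m₁ ≫ b'.inv := by
    rw [Iso.eq_comp_inv, ← h₁, Iso.inv_hom_id_assoc]
  rw [hb, reassoc_of% h, reassoc_of% h₃]

/-- The connecting homomorphism does not depend on the short exact sequence of projective
resolutions used to compute it. -/
theorem ResolutionSES.δ_eq {S : ShortComplex C} (D D' : ResolutionSES S)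
    {E : Type*} [Category* E] [Abelian E] (F : C ⥤ E) [F.Additive] [HasProjectiveResolutions C]
    (n : ℕ) : D.δ F n = D'.δ F n := by
  obtain ⟨φ₁, φ₂, φ₃, hf, hg, h₁, h₃⟩ := D.exists_hom D'
  -- A comparison map over the identity of `Z` induces the identity on the derived functors, so
  -- naturality of the snake map gives equality.
  have aux : ∀ {Z : C} (P Q : ProjectiveResolution Z) (φ : P.complex ⟶ Q.complex),
      φ ≫ Q.π = P.π → ∀ m, (P.isoLeftDerivedObj F m).hom ≫
        (F.mapHomologicalComplex _ ⋙ HomologicalComplex.homologyFunctor _ _ m).map φ =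
          (Q.isoLeftDerivedObj F m).hom := by
    intro Z P Q φ h m
    have h' : φ.f 0 ≫ Q.π.f 0 = P.π.f 0 ≫ 𝟙 Z := by
      rw [← HomologicalComplex.comp_f, h]; exact (Category.comp_id _).symm
    have := ProjectiveResolution.isoLeftDerivedObj_hom_naturality (𝟙 Z) P Q φ h' F m
    rw [← this, CategoryTheory.Functor.map_id, Category.id_comp]
  have e₁ := aux D.P₁ D'.P₁ φ₁ h₁ n
  have e₃ := aux D.P₃ D'.P₃ φ₃ h₃ (n + 1)
  let Φ : (ShortComplex.mk D.f D.g D.zero).map (F.mapHomologicalComplex (ComplexShape.down ℕ)) ⟶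
      (ShortComplex.mk D'.f D'.g D'.zero).map (F.mapHomologicalComplex (ComplexShape.down ℕ)) :=
    (F.mapHomologicalComplex (ComplexShape.down ℕ)).mapShortComplex.map
      (ShortComplex.Hom.mk φ₁ φ₂ φ₃ hf.symm hg.symm)
  have nat := HomologicalComplex.HomologySequence.δ_naturality Φ (D.shortExact_map F)
    (D'.shortExact_map F) (n + 1) n rfl
  change _ ≫ (F.mapHomologicalComplex _ ⋙ HomologicalComplex.homologyFunctor _ _ n).map φ₁ =
    (F.mapHomologicalComplex _ ⋙ HomologicalComplex.homologyFunctor _ _ (n + 1)).map φ₃ ≫ _ at nat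
  exact hom_comp_comp_inv_eq _ _ _ _ nat e₁ e₃

/-- This removes the arbitrary choice in `leftDerivedδ`, so that the explicit twisted resolution can
be used. -/
lemma leftDerivedδ_eq [HasProjectiveResolutions C] {E : Type*} [Category* E] [Abelian E]
    (F : C ⥤ E) [F.Additive] {S : ShortComplex C} (hS : S.ShortExact) (D : ResolutionSES S)
    (n : ℕ) : leftDerivedδ F hS n = D.δ F n :=
  ResolutionSES.δ_eq _ _ F n

end Comparison

/-! ### Horseshoe resolutions from an explicit twisting map -/

section Twist

variable {C : Type u} [Category.{v} C] [Abelian C] {S : ShortComplex C}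

/-- A twisting map `θ : P₃ → P₁[1]` with an augmentation `lam : P₃ → S.X₂` in degree zero. -/
structure Twist (P₁ : ProjectiveResolution S.X₁) (P₃ : ProjectiveResolution S.X₃) where
  lam : P₃.complex.X 0 ⟶ S.X₂
  θ : ∀ n, P₃.complex.X (n + 1) ⟶ P₁.complex.X n
  lam_g : lam ≫ S.g = Horseshoe.aug P₃
  comm_zero : (θ 0 ≫ Horseshoe.aug P₁) ≫ S.f + P₃.complex.d 1 0 ≫ lam = 0
  comm_succ : ∀ n, θ (n + 1) ≫ P₁.complex.d (n + 1) n + P₃.complex.d (n + 2) (n + 1) ≫ θ n = 0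

namespace Twist

variable {P₁ : ProjectiveResolution S.X₁} {P₃ : ProjectiveResolution S.X₃} (t : Twist P₁ P₃)

/-- The twisting map with all pairs of degrees allowed. -/
noncomputable def ext (i j : ℕ) : P₃.complex.X i ⟶ P₁.complex.X j :=
  if h : i = j + 1 then eqToHom (by rw [h]) ≫ t.θ j else 0

lemma ext_succ (j : ℕ) : t.ext (j + 1) j = t.θ j := by simp [ext]

lemma ext_of_not_rel (i j : ℕ) (h : ¬ (ComplexShape.down ℕ).Rel i j) : t.ext i j = 0 := by
  have : ¬ i = j + 1 := fun h' => h (by simp [h'])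
  simp [ext, this]

lemma ext_comm (i j k : ℕ) :
    t.ext i j ≫ P₁.complex.d j k + P₃.complex.d i j ≫ t.ext j k = 0 := by
  by_cases hij : (ComplexShape.down ℕ).Rel i j
  · by_cases hjk : (ComplexShape.down ℕ).Rel j k
    · obtain rfl : j + 1 = i := hij
      obtain rfl : k + 1 = j := hjk
      rw [ext_succ, ext_succ, t.comm_succ]
    · rw [t.ext_of_not_rel j k hjk, P₁.complex.shape j k hjk]; simp
  · rw [t.ext_of_not_rel i j hij, P₃.complex.shape i j hij]; simp

/-- The complex `P₁ ⊞ P₃` with differential twisted by `θ`. -/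
noncomputable abbrev complex : ChainComplex C ℕ :=
  Horseshoe.middle P₁ P₃ t.ext t.ext_of_not_rel t.ext_comm

/-- The inclusion of `P₁` in the twisted complex. -/
noncomputable def inl : P₁.complex ⟶ t.complex where
  f n := (biprod.inl : P₁.complex.X n ⟶ P₁.complex.X n ⊞ P₃.complex.X n)
  comm' i j _ := by
    change biprod.inl ≫ biprod.desc (P₁.complex.d i j ≫ biprod.inl)
      (t.ext i j ≫ biprod.inl + P₃.complex.d i j ≫ biprod.inr) = P₁.complex.d i j ≫ biprod.inl
    simp

/-- The projection of the twisted complex onto `P₃`. -/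
noncomputable def snd : t.complex ⟶ P₃.complex where
  f n := (biprod.snd : P₁.complex.X n ⊞ P₃.complex.X n ⟶ P₃.complex.X n)
  comm' i j _ := by
    change biprod.snd ≫ P₃.complex.d i j = biprod.desc (P₁.complex.d i j ≫ biprod.inl)
      (t.ext i j ≫ biprod.inl + P₃.complex.d i j ≫ biprod.inr) ≫ biprod.snd
    apply biprod.hom_ext' <;> simp

/-- The short exact sequence of projective resolutions whose middle term is twisted by `θ`. -/
noncomputable def resolutionSES (hS : S.ShortExact) : ResolutionSES S := by
  let f : P₁.complex ⟶ t.complex := t.inl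
  let g : t.complex ⟶ P₃.complex := t.snd
  have zero : f ≫ g = 0 := by ext n; exact biprod.inl_snd
  have hT : (ShortComplex.mk f g zero).ShortExact := by
    apply HomologicalComplex.shortExact_of_degreewise_shortExact
    intro n
    exact (ShortComplex.Splitting.ofHasBinaryBiproduct
      (P₁.complex.X n) (P₃.complex.X n)).shortExact
  have hd : (biprod.desc (P₁.complex.d 1 0 ≫ biprod.inl)
      (t.ext 1 0 ≫ biprod.inl + P₃.complex.d 1 0 ≫ biprod.inr) :
        P₁.complex.X 1 ⊞ P₃.complex.X 1 ⟶ P₁.complex.X 0 ⊞ P₃.complex.X 0) ≫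
      biprod.desc (Horseshoe.aug P₁ ≫ S.f) t.lam = 0 := by
    apply biprod.hom_ext'
    · simp [Horseshoe.d_aug_assoc]
    · simpa [t.ext_succ] using t.comm_zero
  let π : t.complex ⟶ (ChainComplex.single₀ C).obj S.X₂ :=
    (ChainComplex.toSingle₀Equiv t.complex S.X₂).symm
      ⟨biprod.desc (Horseshoe.aug P₁ ≫ S.f) t.lam, hd⟩
  have hπ : π.f 0 = biprod.desc (Horseshoe.aug P₁ ≫ S.f) t.lam :=
    ChainComplex.toSingle₀Equiv_symm_apply_f_zero _ _
  have comm_f : f ≫ π = P₁.π ≫ (ChainComplex.single₀ C).map S.f := by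
    apply HomologicalComplex.to_single_hom_ext
    rw [HomologicalComplex.comp_f, HomologicalComplex.comp_f, hπ,
      ChainComplex.single₀_map_f_zero]
    exact biprod.inl_desc _ _
  have comm_g : g ≫ P₃.π = π ≫ (ChainComplex.single₀ C).map S.g := by
    apply HomologicalComplex.to_single_hom_ext
    rw [HomologicalComplex.comp_f, HomologicalComplex.comp_f, hπ,
      ChainComplex.single₀_map_f_zero]
    change biprod.snd ≫ Horseshoe.aug P₃ = biprod.desc (Horseshoe.aug P₁ ≫ S.f) t.lam ≫ S.g
    apply biprod.hom_ext'
    · simp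
    · simp [t.lam_g]
  have hS' : (S.map (ChainComplex.single₀ C)).ShortExact := hS.map_of_exact _
  -- The outer augmentations are quasi-isomorphisms, hence so is the middle one, by the five lemma
  -- on homology.
  have hq : QuasiIso π := quasiIso_τ₂ hT hS' P₃.complex_exactAt_succ
    (fun n => HomologicalComplex.exactAt_single_obj _ _ _ _ (by simp))
    (ShortComplex.Hom.mk P₁.π π P₃.π comm_f.symm comm_g.symm) P₁.quasiIso P₃.quasiIso
  exact ⟨P₁, ⟨t.complex, fun n => inferInstanceAs
    (Projective (P₁.complex.X n ⊞ P₃.complex.X n)), π, hq⟩, P₃, f, g, zero, hT, comm_f, comm_g⟩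

/-- When `F` kills the differentials of the outer resolutions, the connecting homomorphism is given
by the twisting map. -/
lemma liftCycles_δ (hS : S.ShortExact) {E : Type*} [Category* E] [Abelian E] (F : C ⥤ E)
    [F.Additive] (n : ℕ)
    (h₃ : 𝟙 _ ≫ ((F.mapHomologicalComplex (ComplexShape.down ℕ)).obj P₃.complex).d (n + 1) n = 0)
    (h₁ : F.map (t.θ n) ≫
      ((F.mapHomologicalComplex (ComplexShape.down ℕ)).obj P₁.complex).d n
        ((ComplexShape.down ℕ).next n) = 0) :
    ((F.mapHomologicalComplex (ComplexShape.down ℕ)).obj P₃.complex).liftCycles (𝟙 _) n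
        (ChainComplex.next_nat_succ n) h₃ ≫
      ((F.mapHomologicalComplex (ComplexShape.down ℕ)).obj P₃.complex).homologyπ (n + 1) ≫
        ((t.resolutionSES hS).shortExact_map F).δ (n + 1) n rfl =
    ((F.mapHomologicalComplex (ComplexShape.down ℕ)).obj P₁.complex).liftCycles (F.map (t.θ n)) _
        rfl h₁ ≫
      ((F.mapHomologicalComplex (ComplexShape.down ℕ)).obj P₁.complex).homologyπ n := by
  -- Snake chase with the identity as universal cycle: its lift is `F.map biprod.inr`, and the
  -- differential of this lift is `F.map (t.θ n)` in the first summand, because `F` kills the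
  -- differential of `P₃`.
  refine ((t.resolutionSES hS).shortExact_map F).δ_eq (n + 1) n rfl (𝟙 _) h₃
    (F.map (biprod.inr : _ ⟶ P₁.complex.X (n + 1) ⊞ P₃.complex.X (n + 1))) ?_
    (F.map (t.θ n)) ?_ _ rfl
  · refine (F.map_comp _ _).symm.trans (Eq.trans ?_ (F.map_id (P₃.complex.X (n + 1))))
    exact congrArg F.map biprod.inr_snd
  · have h0 : F.map (P₃.complex.d (n + 1) n) = 0 := (Category.id_comp _).symm.trans h₃
    change F.map (t.θ n) ≫ F.map biprod.inl = F.map biprod.inr ≫ F.map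
      (biprod.desc (P₁.complex.d (n + 1) n ≫ biprod.inl)
        (t.ext (n + 1) n ≫ biprod.inl + P₃.complex.d (n + 1) n ≫ biprod.inr))
    rw [← F.map_comp, ← F.map_comp, biprod.inr_desc, t.ext_succ, F.map_add,
      F.map_comp (P₃.complex.d (n + 1) n), h0, zero_comp, add_zero]

end Twist

end Twist
-- Contractions in the exterior algebra
section Exterior

variable {R : Type u} [CommRing R] {M : Type*} [AddCommGroup M] [Module R M]

/-- Contraction of an element of the exterior algebra with a functional. -/
noncomputable def contractExt (φ : Module.Dual R M) : ExteriorAlgebra R M →ₗ[R] ExteriorAlgebra R M :=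
  CliffordAlgebra.contractLeft (Q := (0 : QuadraticForm R M)) φ

lemma coe_contr (φ : Module.Dual R M) (l : ℕ) (x : ⋀[R]^(l + 1) M) :
    (contr φ l x : ExteriorAlgebra R M) = contractExt φ x := rfl

lemma contractExt_ι_mul (φ : Module.Dual R M) (v : M) (x : ExteriorAlgebra R M) :
    contractExt φ (ExteriorAlgebra.ι R v * x) =
      φ v • x - ExteriorAlgebra.ι R v * contractExt φ x :=
  CliffordAlgebra.contractLeft_ι_mul φ v x

lemma contractExt_algebraMap (φ : Module.Dual R M) (a : R) :
    contractExt φ (algebraMap R (ExteriorAlgebra R M) a) = 0 :=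
  CliffordAlgebra.contractLeft_algebraMap _ φ a

lemma contractExt_ι (φ : Module.Dual R M) (v : M) :
    contractExt φ (ExteriorAlgebra.ι R v) = algebraMap R _ (φ v) :=
  CliffordAlgebra.contractLeft_ι _ φ v

lemma contractExt_contractExt (φ : Module.Dual R M) (x : ExteriorAlgebra R M) :
    contractExt φ (contractExt φ x) = 0 :=
  CliffordAlgebra.contractLeft_contractLeft φ x

lemma contractExt_comm (φ ψ : Module.Dual R M) (x : ExteriorAlgebra R M) :
    contractExt φ (contractExt ψ x) = -contractExt ψ (contractExt φ x) :=
  CliffordAlgebra.contractLeft_comm φ ψ x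

lemma ι_mul_mem {l : ℕ} (v : M) {x : ExteriorAlgebra R M} (hx : x ∈ ⋀[R]^l M) :
    ExteriorAlgebra.ι R v * x ∈ ⋀[R]^(l + 1) M := by
  change _ ∈ (LinearMap.range (ExteriorAlgebra.ι R : M →ₗ[R] _)) ^ (l + 1)
  rw [pow_succ']
  exact Submodule.mul_mem_mul (LinearMap.mem_range_self _ _) hx

/-- Induction with the antiderivation rule: each step over the first factor contributes one sign. -/
lemma contractExt_ιMulti (φ : Module.Dual R M) (l : ℕ) (v : Fin (l + 1) → M) :
    contractExt φ (ExteriorAlgebra.ιMulti R (l + 1) v) =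
      ∑ j : Fin (l + 1), ((-1 : R) ^ (j : ℕ) * φ (v j)) •
        ExteriorAlgebra.ιMulti R l (v ∘ j.succAbove) := by
  induction l with
  | zero =>
    rw [ExteriorAlgebra.ιMulti_succ_apply, ExteriorAlgebra.ιMulti_zero_apply, contractExt_ι_mul,
      ← map_one (algebraMap R (ExteriorAlgebra R M)), contractExt_algebraMap]
    simp
  | succ l ih =>
    rw [ExteriorAlgebra.ιMulti_succ_apply, contractExt_ι_mul, ih, Fin.sum_univ_succ (n := l + 1),
      Finset.mul_sum, sub_eq_add_neg, ← Finset.sum_neg_distrib]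
    congr 1
    · simp only [Fin.val_zero, pow_zero, one_mul, Fin.succAbove_zero]
      rfl
    · refine Finset.sum_congr rfl fun j _ => ?_
      rw [ExteriorAlgebra.ιMulti_succ_apply, Fin.val_succ, pow_succ, mul_smul_comm, ← neg_smul]
      congr 1
      · simp only [Matrix.vecTail, Function.comp_apply]; ring
      · have : Matrix.vecTail (v ∘ j.succ.succAbove) = Matrix.vecTail v ∘ j.succAbove := by
          funext a
          simp [Matrix.vecTail]
        rw [this]
        rfl

lemma contr_ιMulti (φ : Module.Dual R M) (l : ℕ) (v : Fin (l + 1) → M) :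
    contr φ l (exteriorPower.ιMulti R (l + 1) v) =
      ∑ j : Fin (l + 1), ((-1 : R) ^ (j : ℕ) * φ (v j)) •
        exteriorPower.ιMulti R l (v ∘ j.succAbove) := by
  refine Subtype.ext ?_
  rw [coe_contr, exteriorPower.ιMulti_apply_coe, contractExt_ιMulti]
  simp

/-- Terms of order at least two in `e` vanish because e ∧ e = 0. For a coordinate functional and its
basis vector, the map on the left sets that coordinate to zero. -/
lemma map_sub_ι_mul_contractExt (φ : Module.Dual R M) (e : M) (x : ExteriorAlgebra R M) :
    ExteriorAlgebra.map (LinearMap.id - φ.smulRight e) x =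
      x - ExteriorAlgebra.ι R e * contractExt φ x := by
  induction x using CliffordAlgebra.left_induction with
  | algebraMap a =>
    rw [AlgHom.commutes]
    erw [contractExt_algebraMap]
    simp
  | add x y hx hy => rw [map_add, map_add, hx, hy, mul_add]; abel
  | ι_mul x v h =>
    change ExteriorAlgebra.map _ (ExteriorAlgebra.ι R v * x) =
      ExteriorAlgebra.ι R v * x - ExteriorAlgebra.ι R e * contractExt φ (ExteriorAlgebra.ι R v * x)
    have h1 : ExteriorAlgebra.ι R e * ExteriorAlgebra.ι R e = 0 := ExteriorAlgebra.ι_sq_zero e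
    have h2 : ExteriorAlgebra.ι R v * ExteriorAlgebra.ι R e =
        - (ExteriorAlgebra.ι R e * ExteriorAlgebra.ι R v) :=
      eq_neg_of_add_eq_zero_left (ExteriorAlgebra.ι_add_mul_swap v e)
    rw [map_mul, h, ExteriorAlgebra.map_apply_ι, contractExt_ι_mul]
    simp only [LinearMap.sub_apply, LinearMap.id_apply, LinearMap.smulRight_apply, map_sub,
      map_smul, sub_mul, mul_sub, smul_mul_assoc, mul_smul_comm]
    rw [← mul_assoc (ExteriorAlgebra.ι R v), h2, ← mul_assoc (ExteriorAlgebra.ι R e) _ (contractExt φ x),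
      h1, ← mul_assoc (ExteriorAlgebra.ι R e) (ExteriorAlgebra.ι R v)]
    simp only [neg_mul, zero_mul, smul_zero, sub_zero]
    abel

end Exterior

/-! ### Exactness of the Koszul complex -/

section KoszulExact

variable {R : Type u} [CommRing R] {n : ℕ}

/-- The ideal generated by the entries of `r` with index less than `k`. -/
def prefixIdeal (r : Fin n → R) (k : ℕ) : Ideal R := Ideal.span {x | ∃ i : Fin n, (i : ℕ) < k ∧ r i = x}

lemma mem_prefixIdeal_iff (r : Fin n → R) (k : ℕ) (b : R) :
    b ∈ prefixIdeal r k ↔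
      ∃ w : Fin n → R, (∀ i : Fin n, k ≤ i → w i = 0) ∧ ∑ i, r i * w i = b := by
  constructor
  · intro h
    induction h using Submodule.span_induction with
    | mem x hx =>
      obtain ⟨i, hi, rfl⟩ := hx
      exact ⟨Pi.single i 1, fun j hj => Pi.single_eq_of_ne (by rintro rfl; omega) _,
        by simp [Pi.single_apply]⟩
    | zero => exact ⟨0, by simp⟩
    | add x y _ _ hx hy =>
      obtain ⟨v, hv, rfl⟩ := hx
      obtain ⟨w, hw, rfl⟩ := hy
      exact ⟨v + w, fun i hi => by simp [hv i hi, hw i hi], by simp [mul_add, Finset.sum_add_distrib]⟩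
    | smul a x _ hx =>
      obtain ⟨v, hv, rfl⟩ := hx
      exact ⟨a • v, fun i hi => by simp [hv i hi], by
        simp only [Pi.smul_apply, smul_eq_mul, Finset.mul_sum]
        exact Finset.sum_congr rfl fun i _ => by ring⟩
  · rintro ⟨w, hw, rfl⟩
    refine Ideal.sum_mem _ fun i _ => ?_
    by_cases hi : (i : ℕ) < k
    · exact Ideal.mul_mem_right _ _ (Ideal.subset_span ⟨i, hi, rfl⟩)
    · rw [hw i (by omega), mul_zero]; exact Ideal.zero_mem _

lemma prefixIdeal_mono (r : Fin n → R) {k k' : ℕ} (h : k ≤ k') :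
    prefixIdeal r k ≤ prefixIdeal r k' :=
  Ideal.span_mono fun _ ⟨i, hi, hx⟩ => ⟨i, hi.trans_le h, hx⟩

lemma prefixIdeal_self (r : Fin n → R) : prefixIdeal r n = seqIdeal r := by
  rw [prefixIdeal, seqIdeal]
  congr 1
  ext x
  simp

/-- Elementwise form of weak regularity: `r k` is a nonzerodivisor modulo the previous entries. -/
def IsRegularSeq (r : Fin n → R) : Prop :=
  ∀ (k : Fin n) (b : R), r k * b ∈ prefixIdeal r k → b ∈ prefixIdeal r k

lemma isRegularSeq_of_isWeaklyRegular {r : Fin n → R}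
    (hr : RingTheory.Sequence.IsWeaklyRegular R (List.ofFn r)) : IsRegularSeq r := by
  intro k b hb
  have h := hr.regular_mod_prev k (by simp)
  have hI : (Ideal.ofList ((List.ofFn r).take k) • ⊤ : Submodule R R) = prefixIdeal r k := by
    rw [smul_eq_mul, Ideal.mul_top, Ideal.ofList, prefixIdeal]
    congr 1
    ext x
    simp only [List.mem_take_iff_getElem, List.length_ofFn, List.getElem_ofFn, Set.mem_ofPred_eq]
    constructor
    · rintro ⟨i, hi, rfl⟩
      exact ⟨⟨i, by omega⟩, by simp; omega, rfl⟩
    · rintro ⟨i, hi, rfl⟩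
      exact ⟨i, by omega, rfl⟩
  rw [hI, isSMulRegular_iff_right_eq_zero_of_smul] at h
  have := h (Submodule.Quotient.mk b) (by
    rw [← Submodule.Quotient.mk_smul, Submodule.Quotient.mk_eq_zero]
    simpa using hb)
  exact (Submodule.Quotient.mk_eq_zero _).1 this

/-- Contraction with the `i`-th coordinate functional. -/
noncomputable abbrev coordContract (i : Fin n) :
    ExteriorAlgebra R (Fin n → R) →ₗ[R] ExteriorAlgebra R (Fin n → R) :=
  contractExt (LinearMap.proj i : (Fin n → R) →ₗ[R] R)

lemma map_zero_of_mem {l : ℕ} {ω : ExteriorAlgebra R (Fin n → R)}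
    (hω : ω ∈ ⋀[R]^(l + 1) (Fin n → R)) :
    ExteriorAlgebra.map (0 : (Fin n → R) →ₗ[R] (Fin n → R)) ω = 0 := by
  change ω ∈ (LinearMap.range (ExteriorAlgebra.ι R : (Fin n → R) →ₗ[R] _)) ^ (l + 1) at hω
  rw [pow_succ'] at hω
  induction hω using Submodule.mul_induction_on' with
  | mem_mul_mem a ha b hb =>
    obtain ⟨m, rfl⟩ := ha
    rw [map_mul, ExteriorAlgebra.map_apply_ι]
    simp
  | add a _ b _ ha hb => rw [map_add, ha, hb, add_zero]

/-- By `map_sub_ι_mul_contractExt`, setting one coordinate to zero fixes `ω`. After all coordinates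
the induced map is that of the zero endomorphism, which kills positive degrees. -/
lemma eq_zero_of_coordContract_eq_zero {l : ℕ} {ω : ExteriorAlgebra R (Fin n → R)}
    (hω : ω ∈ ⋀[R]^(l + 1) (Fin n → R)) (h : ∀ i, coordContract i ω = 0) : ω = 0 := by
  classical
  have key : ∀ S : Finset (Fin n), ExteriorAlgebra.map
      (LinearMap.pi fun i => if i ∈ S then 0 else (LinearMap.proj i : (Fin n → R) →ₗ[R] R)) ω
        = ω := by
    intro S
    induction S using Finset.induction_on with
    | empty =>
      have : (LinearMap.pi fun i => if i ∈ (∅ : Finset (Fin n)) then 0 else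
          (LinearMap.proj i : (Fin n → R) →ₗ[R] R)) = LinearMap.id := by ext; simp
      rw [this, ExteriorAlgebra.map_id]; rfl
    | insert a S _ ih =>
      have : (LinearMap.pi fun i => if i ∈ insert a S then 0 else
          (LinearMap.proj i : (Fin n → R) →ₗ[R] R)) =
          (LinearMap.pi fun i => if i ∈ S then 0 else
            (LinearMap.proj i : (Fin n → R) →ₗ[R] R)) ∘ₗ
          (LinearMap.id - (LinearMap.proj a : (Fin n → R) →ₗ[R] R).smulRight (Pi.single a 1)) := by
        refine LinearMap.ext fun v => funext fun i => ?_
        by_cases hia : i = a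
        · subst hia
          by_cases hi : i ∈ S <;> simp [hi]
        · by_cases hi : i ∈ S <;> simp [hi, hia]
      rw [this, ← ExteriorAlgebra.map_comp_map, AlgHom.comp_apply, map_sub_ι_mul_contractExt]
      erw [h a]
      rw [mul_zero, sub_zero, ih]
  have h0 : (LinearMap.pi fun i => if i ∈ (Finset.univ : Finset (Fin n)) then 0 else
      (LinearMap.proj i : (Fin n → R) →ₗ[R] R)) = 0 := by
    ext; simp
  rw [← key Finset.univ, h0]
  exact map_zero_of_mem hω

/-- Vanishing of the contractions from index `k` on says that only the first `k` basis vectors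
occur, so the induction on `k` stays in one exterior algebra with one differential d. Write ω = α +
e ∧ β with e the new basis vector. Then dω = 0 means dβ = 0 and dα = -r_a β. If β = dγ, then α + r_a
γ is a cycle without e, hence has a primitive by induction. -/
lemma exists_koszul_primitive {r : Fin n → R} (hr : IsRegularSeq r) {k : ℕ} (hk : k ≤ n) :
    ∀ (l : ℕ) (ω : ExteriorAlgebra R (Fin n → R)), ω ∈ ⋀[R]^(l + 1) (Fin n → R) →
      (∀ i : Fin n, k ≤ i → coordContract i ω = 0) →
      contractExt (∑ i, r i • (LinearMap.proj i : (Fin n → R) →ₗ[R] R)) ω = 0 →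
      ∃ η ∈ ⋀[R]^(l + 2) (Fin n → R), (∀ i : Fin n, k ≤ i → coordContract i η = 0) ∧
        contractExt (∑ i, r i • (LinearMap.proj i : (Fin n → R) →ₗ[R] R)) η = ω := by
  set φ : Module.Dual R (Fin n → R) := ∑ i, r i • LinearMap.proj i with hφ
  have hφv : ∀ v, φ v = ∑ i, r i * v i := fun v => by simp [hφ, LinearMap.sum_apply]
  induction k with
  | zero =>
    intro l ω hω h _
    have : ω = 0 := eq_zero_of_coordContract_eq_zero hω fun i => h i (Nat.zero_le _)
    exact ⟨0, Submodule.zero_mem _, by simp, by simp [this]⟩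
  | succ k ih =>
    intro l ω hω h hd
    let a : Fin n := ⟨k, hk⟩
    let e : ExteriorAlgebra R (Fin n → R) := ExteriorAlgebra.ι R (Pi.single a 1)
    have hφa : φ (Pi.single a 1) = r a := by simp [hφv, Pi.single_apply]
    have hcomm : ∀ (i : Fin n), k ≤ i → ∀ x, (∀ j : Fin n, k ≤ j → coordContract j x = 0) →
        coordContract i (e * x) = if i = a then x else 0 := by
      intro i hi x hx
      rw [coordContract, contractExt_ι_mul, hx i hi, mul_zero, sub_zero, LinearMap.proj_apply]
      by_cases hia : i = a
      · subst hia; simp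
      · simp [hia]
    have hde : ∀ x, contractExt φ (e * x) = r a • x - e * contractExt φ x := fun x => by
      rw [contractExt_ι_mul, hφa]
    -- Contraction with the coordinate `a` extracts the factor of `e` in `ω`.
    set β := coordContract a ω with hβ
    have hβm : β ∈ ⋀[R]^l (Fin n → R) := contractLeft_mem _ l hω
    have hβk : ∀ i : Fin n, k ≤ i → coordContract i β = 0 := by
      intro i hi
      by_cases hia : i = a
      · subst hia; exact contractExt_contractExt _ _
      · have : (i : ℕ) ≠ k := fun h' => hia (Fin.ext h')
        rw [hβ, coordContract, contractExt_comm, h i (by omega), map_zero, neg_zero]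
    have hβd : contractExt φ β = 0 := by
      rw [hβ, contractExt_comm, hd, map_zero, neg_zero]
    set α := ω - e * β with hα
    have hαm : α ∈ ⋀[R]^(l + 1) (Fin n → R) := Submodule.sub_mem _ hω (ι_mul_mem _ hβm)
    have hαk : ∀ i : Fin n, k ≤ i → coordContract i α = 0 := by
      intro i hi
      rw [hα, map_sub, hcomm i hi β hβk]
      split_ifs with hia
      · rw [hia, hβ, sub_self]
      · have : (i : ℕ) ≠ k := fun h' => hia (Fin.ext h')
        rw [h i (by omega), sub_zero]
    have hαd : contractExt φ α = -(r a • β) := by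
      rw [hα, map_sub, hd, hde, hβd, mul_zero, sub_zero, zero_sub]
    obtain ⟨γ, hγm, hγk, hγd⟩ : ∃ γ ∈ ⋀[R]^(l + 1) (Fin n → R),
        (∀ i : Fin n, k ≤ i → coordContract i γ = 0) ∧ contractExt φ γ = β := by
      cases l with
      | succ l => exact ih (by omega) l β hβm hβk hβd
      -- Here β is a scalar b and α a vector v, so dα = -r_a b places r_a b in the ideal of the
      -- earlier entries. This is the only use of regularity: b = ∑ rᵢwᵢ, and γ = w.
      | zero =>
        change β ∈ (LinearMap.range (ExteriorAlgebra.ι R : (Fin n → R) →ₗ[R] _)) ^ 0 at hβm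
        rw [pow_zero, Submodule.mem_one] at hβm
        obtain ⟨b, hb⟩ := hβm
        change α ∈ (LinearMap.range (ExteriorAlgebra.ι R : (Fin n → R) →ₗ[R] _)) ^ (0 + 1) at hαm
        rw [zero_add, pow_one] at hαm
        obtain ⟨v, hv⟩ := hαm
        have hinj := (ExteriorAlgebra.algebraMap_leftInverse (R := R) (Fin n → R)).injective
        have hvk : ∀ i : Fin n, k ≤ i → v i = 0 := by
          intro i hi
          have := hαk i hi
          rw [← hv, coordContract, contractExt_ι] at this
          exact hinj (this.trans (map_zero _).symm)
        have hrb : r a * b ∈ prefixIdeal r k := by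
          rw [← neg_mem_iff, mem_prefixIdeal_iff]
          refine ⟨v, hvk, ?_⟩
          rw [← hv, contractExt_ι, ← hb, hφv] at hαd
          apply hinj
          rw [hαd, map_neg, map_mul, Algebra.smul_def]
        obtain ⟨w, hwk, hw⟩ := (mem_prefixIdeal_iff r k b).1 (hr a b hrb)
        refine ⟨ExteriorAlgebra.ι R w, ?_, ?_, ?_⟩
        · change _ ∈ (LinearMap.range (ExteriorAlgebra.ι R : (Fin n → R) →ₗ[R] _)) ^ (0 + 1)
          rw [zero_add, pow_one]
          exact LinearMap.mem_range_self _ _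
        · intro i hi
          rw [coordContract, contractExt_ι, LinearMap.proj_apply, hwk i hi, map_zero]
        · rw [contractExt_ι, hφv, hw, hb]
    obtain ⟨ζ, hζm, hζk, hζd⟩ := ih (by omega) l (α + r a • γ)
      (Submodule.add_mem _ hαm (Submodule.smul_mem _ _ hγm))
      (fun i hi => by rw [map_add, map_smul, hαk i hi, hγk i hi, smul_zero, add_zero])
      (by rw [map_add, map_smul, hαd, hγd, neg_add_cancel])
    -- d(ζ - e ∧ γ) = (α + r_a γ) - r_a γ + e ∧ β = ω.
    refine ⟨ζ - e * γ, Submodule.sub_mem _ hζm (ι_mul_mem _ hγm), ?_, ?_⟩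
    · intro i hi
      rw [map_sub, hζk i (by omega), hcomm i (by omega) γ hγk, if_neg, sub_zero]
      rintro rfl
      simp [a] at hi
    · rw [map_sub, hζd, hde, hγd, hα]
      abel

/-- The Koszul complex of a regular sequence is exact in positive degrees. -/
lemma koszulD_exact {r : Fin n → R} (hr : IsRegularSeq r) (l : ℕ) :
    Function.Exact (koszulD r (l + 1)) (koszulD r l) := by
  intro x
  constructor
  · intro hx
    obtain ⟨η, hη, -, h⟩ := exists_koszul_primitive hr le_rfl l x x.2
      (fun i hi => absurd i.2 (by omega)) (congrArg Subtype.val hx)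
    exact ⟨⟨η, hη⟩, Subtype.ext h⟩
  · rintro ⟨y, rfl⟩
    exact LinearMap.congr_fun (contr_comp _ l) y

end KoszulExact
-- Regular sequences are quasi-regular
section QuasiRegular

open MvPolynomial

variable {R : Type u} [CommRing R] {n : ℕ}

/-- Homogeneous polynomials of degree `s` in the variables of index less than `k`. -/
def IsPrefixForm (k s : ℕ) (F : MvPolynomial (Fin n) R) : Prop :=
  ∀ m, coeff m F ≠ 0 → m.degree = s ∧ ∀ i : Fin n, k ≤ i → m i = 0

lemma IsPrefixForm.add {k s : ℕ} {F G : MvPolynomial (Fin n) R} (hF : IsPrefixForm k s F)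
    (hG : IsPrefixForm k s G) : IsPrefixForm k s (F + G) := by
  intro m hm
  by_cases h : coeff m F = 0
  · exact hG m fun h' => hm (by rw [coeff_add, h, h', add_zero])
  · exact hF m h

lemma IsPrefixForm.C_mul {k s : ℕ} {F : MvPolynomial (Fin n) R} (hF : IsPrefixForm k s F) (a : R) :
    IsPrefixForm k s (C a * F) :=
  fun m hm => hF m fun h => hm (by rw [coeff_C_mul, h, mul_zero])

/-- With `A` the whole ring this bounds the value by the `s`-th power; with `A = prefixIdeal r k` it
gains one further power. -/
lemma IsPrefixForm.eval_mem {k s : ℕ} {F : MvPolynomial (Fin n) R} (hF : IsPrefixForm k s F)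
    (r : Fin n → R) (A : Ideal R) (hA : ∀ m, coeff m F ∈ A) :
    eval r F ∈ A * prefixIdeal r k ^ s := by
  rw [eval_eq']
  refine Ideal.sum_mem _ fun m hm => Ideal.mul_mem_mul (hA m) ?_
  obtain ⟨hs, hk⟩ := hF m (mem_support_iff.1 hm)
  have h : ∏ i, r i ^ m i ∈ ∏ i, prefixIdeal r k ^ m i := by
    refine Ideal.prod_mem_prod fun i _ => ?_
    by_cases hi : (i : ℕ) < k
    · exact Ideal.pow_mem_pow (show r i ∈ prefixIdeal r k from Ideal.subset_span ⟨i, hi, rfl⟩) _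
    · rw [hk i (by omega)]; simp
  rwa [Finset.prod_pow_eq_pow_sum, ← Finsupp.degree_eq_sum, hs] at h

lemma mem_prefixIdeal_pow_iff (r : Fin n → R) (k s : ℕ) (y : R) :
    y ∈ prefixIdeal r k ^ s ↔ ∃ F, IsPrefixForm k s F ∧ eval r F = y := by
  constructor
  · intro h
    have hI : prefixIdeal r k = Ideal.span (Set.range fun i : {i : Fin n // (i : ℕ) < k} => r i) := by
      rw [prefixIdeal]
      congr 1
      ext x
      simp
    rw [hI, Ideal.mem_span_pow_iff_exists_isHomogeneous] at h
    obtain ⟨p, hp, rfl⟩ := h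
    refine ⟨rename Subtype.val p, ?_, by rw [eval_rename]; rfl⟩
    intro m hm
    obtain ⟨u, rfl, hu⟩ := coeff_rename_ne_zero _ _ _ hm
    refine ⟨?_, fun i hi => ?_⟩
    · rw [Finsupp.degree_eq_weight_one]
      exact hp.rename_isHomogeneous hm
    · refine Finsupp.mapDomain_of_notMem_range _ _ ?_
      rintro ⟨j, rfl⟩
      exact absurd j.2 (by omega)
  · rintro ⟨F, hF, rfl⟩
    simpa using hF.eval_mem r ⊤ fun _ => Submodule.mem_top

lemma exists_prefixForm_of_mem_pow_succ (r : Fin n → R) (k s : ℕ) {y : R}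
    (hy : y ∈ prefixIdeal r k ^ (s + 1)) :
    ∃ F, IsPrefixForm k s F ∧ eval r F = y ∧ ∀ m, coeff m F ∈ prefixIdeal r k := by
  rw [pow_succ'] at hy
  induction hy using Submodule.mul_induction_on' with
  | mem_mul_mem a ha b hb =>
    obtain ⟨F, hF, rfl⟩ := (mem_prefixIdeal_pow_iff r k s b).1 hb
    exact ⟨C a * F, hF.C_mul a, by simp, fun m => by
      rw [coeff_C_mul]; exact Ideal.mul_mem_right _ _ ha⟩
  | add a _ b _ ha hb =>
    obtain ⟨F, hF, rfl, hF'⟩ := ha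
    obtain ⟨G, hG, rfl, hG'⟩ := hb
    exact ⟨F + G, hF.add hG, by simp, fun m => by
      rw [coeff_add]; exact Ideal.add_mem _ (hF' m) (hG' m)⟩

/-- The relations of degree `s` between the first `k` entries of `r` have their coefficients in
the ideal generated by these entries. -/
def QuasiRegularAt (r : Fin n → R) (k s : ℕ) : Prop :=
  ∀ F, IsPrefixForm k s F → eval r F = 0 → ∀ m, coeff m F ∈ prefixIdeal r k

/-- A value in the power `s + 1` is also the value of a form of degree `s` with coefficients in the
ideal; subtracting that form leaves an exact relation. -/
lemma QuasiRegularAt.coeff_mem {r : Fin n → R} {k s : ℕ} (h : QuasiRegularAt r k s)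
    {F : MvPolynomial (Fin n) R} (hF : IsPrefixForm k s F)
    (hy : eval r F ∈ prefixIdeal r k ^ (s + 1)) (m : Fin n →₀ ℕ) :
    coeff m F ∈ prefixIdeal r k := by
  obtain ⟨G, hG, hGF, hG'⟩ := exists_prefixForm_of_mem_pow_succ r k s hy
  have := h (F + C (-1) * G) (hF.add (hG.C_mul _)) (by simp [hGF]) m
  rw [coeff_add, coeff_C_mul, neg_one_mul] at this
  simpa using Ideal.add_mem _ this (hG' m)

/-- Climb one power at a time. If y = G(r) with G of degree s, quasi-regularity applied to r_k G
puts r_k times each coefficient of G in the ideal; regularity cancels r_k, so y gains a power. -/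
lemma mem_pow_of_mul_mem_pow {r : Fin n → R} (hr : IsRegularSeq r) (k : Fin n)
    (h : ∀ s, QuasiRegularAt r k s) (s : ℕ) {y : R} (hy : r k * y ∈ prefixIdeal r k ^ s) :
    y ∈ prefixIdeal r k ^ s := by
  induction s with
  | zero => simp
  | succ s ih =>
    obtain ⟨G, hG, rfl⟩ := (mem_prefixIdeal_pow_iff r k s y).1
      (ih (Ideal.pow_le_pow_right (Nat.le_succ s) hy))
    rw [pow_succ']
    refine hG.eval_mem r _ fun m => hr k _ ?_
    have := (h s).coeff_mem (hG.C_mul (r k)) (by simpa using hy) m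
    rwa [coeff_C_mul] at this

lemma eq_zero_of_eval_eq_zero {r : Fin n → R} {F : MvPolynomial (Fin n) R}
    (hF : ∀ m, coeff m F ≠ 0 → m = 0) (h : eval r F = 0) : F = 0 := by
  have hC : F = C (coeff 0 F) := by
    ext m
    rw [coeff_C]
    split_ifs with hm
    · rw [hm]
    · by_contra h'
      exact hm (hF m h').symm
  rw [hC, eval_C] at h
  rw [hC, h, C_0]

/-- Double induction on `k` and `s`: split F = x_a H + G with G free of the last variable x_a, then
treat H by induction on the degree and G by induction on the number of variables. -/
lemma quasiRegularAt_of_isRegularSeq {r : Fin n → R} (hr : IsRegularSeq r) {k : ℕ} (hk : k ≤ n)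
    (s : ℕ) : QuasiRegularAt r k s := by
  induction k generalizing s with
  | zero =>
    intro F hF h m
    rw [eq_zero_of_eval_eq_zero (fun m hm => Finsupp.ext fun i =>
      (hF m hm).2 i (Nat.zero_le _)) h, coeff_zero]
    exact Ideal.zero_mem _
  | succ k ihk =>
    have hQ : ∀ s, QuasiRegularAt r k s := ihk (by omega)
    let a : Fin n := ⟨k, hk⟩
    induction s with
    | zero =>
      intro F hF h m
      rw [eq_zero_of_eval_eq_zero (fun m hm => (Finsupp.degree_eq_zero_iff m).1 (hF m hm).1) h,
        coeff_zero]
      exact Ideal.zero_mem _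
    | succ s ihs =>
      intro F hF h
      have hle := prefixIdeal_mono r (Nat.le_succ k)
      have hra : r a ∈ prefixIdeal r (k + 1) := Ideal.subset_span ⟨a, Nat.lt_succ_self k, rfl⟩
      set H := F.divMonomial (Finsupp.single a 1) with hH
      set G := F.modMonomial (Finsupp.single a 1) with hG
      have hFGH : X a * H + G = F := divMonomial_add_modMonomial_single F a
      have hHf : IsPrefixForm (k + 1) s H := by
        intro m hm
        rw [hH, coeff_divMonomial] at hm
        obtain ⟨h1, h2⟩ := hF _ hm
        rw [map_add, Finsupp.degree_single] at h1
        refine ⟨by omega, fun i hi => ?_⟩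
        have := h2 i hi
        rw [Finsupp.add_apply] at this
        omega
      have hGf : IsPrefixForm k (s + 1) G := by
        intro m hm
        have hle' : ¬ Finsupp.single a 1 ≤ m := fun h' =>
          hm (coeff_modMonomial_of_le _ h')
        rw [hG, coeff_modMonomial_of_not_le _ hle'] at hm
        obtain ⟨h1, h2⟩ := hF _ hm
        refine ⟨h1, fun i hi => ?_⟩
        by_cases hia : i = a
        · subst hia
          rw [Finsupp.single_le_iff] at hle'
          omega
        · have : (i : ℕ) ≠ k := fun h' => hia (Fin.ext h')
          exact h2 i (by omega)
      have heval : r a * eval r H + eval r G = 0 := by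
        rw [← h, ← hFGH]; simp
      -- r_a H(r) = -G(r) lies in this power, and r_a is a nonzerodivisor modulo it.
      have hHm : eval r H ∈ prefixIdeal r k ^ (s + 1) := by
        refine mem_pow_of_mul_mem_pow hr a hQ (s + 1) ?_
        rw [eq_neg_of_add_eq_zero_left heval, neg_mem_iff]
        exact (mem_prefixIdeal_pow_iff r k (s + 1) _).2 ⟨G, hGf, rfl⟩
      have hHc := ihs.coeff_mem hHf (Ideal.pow_right_mono hle _ hHm)
      -- Replacing H by a form K without x_a of the same value turns the relation into r_a K + G,
      -- which involves only the first `k` variables. Its coefficients agree with those of G modulo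
      -- r_a.
      obtain ⟨K, hK, hKe⟩ := (mem_prefixIdeal_pow_iff r k (s + 1) _).1 hHm
      have hGc : ∀ m, coeff m G ∈ prefixIdeal r (k + 1) := by
        intro m
        have := hle (hQ (s + 1) (C (r a) * K + G) ((hK.C_mul _).add hGf)
          (by simpa [hKe] using heval) m)
        rw [coeff_add, coeff_C_mul] at this
        exact (Ideal.add_mem_iff_right _ (Ideal.mul_mem_right _ _ hra)).1 this
      intro m
      rw [← hFGH, coeff_add, coeff_X_mul']
      refine Ideal.add_mem _ ?_ (hGc m)
      split_ifs
      · exact hHc _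
      · exact Ideal.zero_mem _

/-- A regular sequence is quasi-regular. -/
theorem coeff_mem_of_eval_mem {r : Fin n → R} (hr : IsRegularSeq r) {s : ℕ}
    {F : MvPolynomial (Fin n) R} (hF : F.IsHomogeneous s)
    (h : eval r F ∈ seqIdeal r ^ (s + 1)) (m : Fin n →₀ ℕ) : coeff m F ∈ seqIdeal r := by
  rw [← prefixIdeal_self] at h ⊢
  refine (quasiRegularAt_of_isRegularSeq hr le_rfl s).coeff_mem ?_ h m
  intro m hm
  refine ⟨?_, fun i hi => absurd i.2 (by omega)⟩
  rw [Finsupp.degree_eq_weight_one]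
  exact hF hm

end QuasiRegular
-- The columns are resolutions
section ColumnExact

variable {R : Type u} [CommRing R] {n : ℕ}

lemma neg_one_pow_smul_smul {M : Type*} [AddCommMonoid M] [Module R M] (s : ℕ) (x : M) :
    (-1 : R) ^ s • (-1 : R) ^ s • x = x := by
  rw [smul_smul, ← mul_pow, neg_one_mul, neg_neg, one_pow, one_smul]

lemma neg_one_pow_smul_eq_zero_iff {M : Type*} [AddCommGroup M] [Module R M] (s : ℕ) (x : M) :
    (-1 : R) ^ s • x = 0 ↔ x = 0 :=
  ⟨fun h => by rw [← neg_one_pow_smul_smul (R := R) s x, h, smul_zero], fun h => by rw [h, smul_zero]⟩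

lemma exact_neg_one_pow_smul {M N P : Type*} [AddCommGroup M] [Module R M] [AddCommGroup N]
    [Module R N] [AddCommGroup P] [Module R P] {f : M →ₗ[R] N} {g : N →ₗ[R] P}
    (h : Function.Exact f g) (s t : ℕ) :
    Function.Exact ((-1 : R) ^ s • f) ((-1 : R) ^ t • g) := by
  intro x
  rw [LinearMap.smul_apply, neg_one_pow_smul_eq_zero_iff, h x]
  constructor
  · rintro ⟨y, rfl⟩
    exact ⟨(-1 : R) ^ s • y, by rw [LinearMap.smul_apply, map_smul, neg_one_pow_smul_smul]⟩
  · rintro ⟨y, rfl⟩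
    exact ⟨(-1 : R) ^ s • y, by rw [map_smul, LinearMap.smul_apply]⟩

lemma colD_exact {r : Fin n → R} (hr : IsRegularSeq r) (s l : ℕ) :
    Function.Exact (colD r s (l + 1)) (colD r s l) :=
  exact_neg_one_pow_smul (Module.Flat.rTensor_exact _ (koszulD_exact hr l)) s s

/-- The unit of the exterior algebra. -/
noncomputable def extOne (R : Type u) [CommRing R] (n : ℕ) : ExtPow R n 0 :=
  exteriorPower.ιMulti R 0 Fin.elim0

lemma zeroEquiv_extOne : exteriorPower.zeroEquiv R (Fin n → R) (extOne R n) = 1 :=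
  exteriorPower.zeroEquiv_ιMulti _

lemma eq_smul_extOne (x : ExtPow R n 0) :
    x = exteriorPower.zeroEquiv R (Fin n → R) x • extOne R n := by
  apply (exteriorPower.zeroEquiv R (Fin n → R)).injective
  rw [map_smul, zeroEquiv_extOne, smul_eq_mul, mul_one]

lemma exists_extOne_tmul {N : Type*} [AddCommGroup N] [Module R N] (x : ExtPow R n 0 ⊗[R] N) :
    ∃ f, x = extOne R n ⊗ₜ[R] f := by
  induction x using TensorProduct.induction_on with
  | zero => exact ⟨0, by simp⟩
  | tmul a f =>
    exact ⟨exteriorPower.zeroEquiv R (Fin n → R) a • f, by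
      rw [← TensorProduct.smul_tmul, ← eq_smul_extOne]⟩
  | add x y hx hy =>
    obtain ⟨f, rfl⟩ := hx
    obtain ⟨g, rfl⟩ := hy
    exact ⟨f + g, by rw [TensorProduct.tmul_add]⟩

lemma augLin_extOne_tmul (r : Fin n → R) (s : ℕ) (f : Forms R n s) :
    augLin r s (extOne R n ⊗ₜ f) = (-1 : R) ^ (s * (s + 1) / 2) • evalForms r s f := by
  simp [augLin, zeroEquiv_extOne]

lemma evalForms_eq_zero_iff (r : Fin n → R) (s : ℕ) (f : Forms R n s) :
    evalForms r s f = 0 ↔ MvPolynomial.eval r f.1 ∈ seqIdeal r ^ (s + 1) :=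
  Submodule.Quotient.mk_eq_zero _

lemma evalForms_surjective (r : Fin n → R) (s : ℕ) : Function.Surjective (evalForms r s) := by
  intro x
  obtain ⟨⟨x, hx⟩, rfl⟩ := Submodule.Quotient.mk_surjective _ x
  obtain ⟨p, hp, rfl⟩ := (Ideal.mem_span_pow_iff_exists_isHomogeneous r x).1 hx
  exact ⟨⟨p, hp⟩, rfl⟩

lemma exists_sum_smul_of_coeff_mem (r : Fin n → R) {s : ℕ} (f : Forms R n s)
    (h : ∀ m, MvPolynomial.coeff m f.1 ∈ seqIdeal r) :
    ∃ g : Fin n → Forms R n s, f = ∑ i, r i • g i := by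
  have h' : ∀ m, ∃ w : Fin n → R, ∑ i, r i * w i = MvPolynomial.coeff m f.1 := fun m => by
    have := h m
    rw [← prefixIdeal_self, mem_prefixIdeal_iff] at this
    obtain ⟨w, -, hw⟩ := this
    exact ⟨w, hw⟩
  choose w hw using h'
  refine ⟨fun i => ⟨∑ m ∈ f.1.support, MvPolynomial.monomial m (w m i), ?_⟩, ?_⟩
  · refine Submodule.sum_mem _ fun m hm => MvPolynomial.isHomogeneous_monomial _ ?_
    rw [Finsupp.degree_eq_weight_one]
    exact f.2 (MvPolynomial.mem_support_iff.1 hm)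
  · refine Subtype.ext ?_
    rw [Submodule.coe_sum]
    simp only [Submodule.coe_smul, Finset.smul_sum, MvPolynomial.smul_monomial, smul_eq_mul]
    rw [Finset.sum_comm]
    conv_lhs => rw [f.1.as_sum]
    refine Finset.sum_congr rfl fun m _ => ?_
    rw [← map_sum, hw]

lemma koszulD_apply (r : Fin n → R) (l : ℕ) (v : Fin (l + 1) → Fin n → R) :
    koszulD r l (exteriorPower.ιMulti R (l + 1) v) =
      ∑ j : Fin (l + 1), ((-1 : R) ^ (j : ℕ) * ∑ i, r i * v j i) •
        exteriorPower.ιMulti R l (v ∘ j.succAbove) := by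
  rw [koszulD, contr_ιMulti]
  simp [LinearMap.sum_apply]

lemma koszulD_zero_single (r : Fin n → R) (i : Fin n) :
    koszulD r 0 (exteriorPower.ιMulti R 1 fun _ => Pi.single i 1) = r i • extOne R n := by
  refine (koszulD_apply r 0 _).trans ((Fin.sum_univ_one _).trans ?_)
  simp only [Fin.val_zero, pow_zero, one_mul, Pi.single_apply, mul_ite, mul_one,
    mul_zero, Finset.sum_ite_eq', Finset.mem_univ, if_true]
  rw [extOne]
  congr 2
  exact Subsingleton.elim _ _

/-- If f(r) ∈ I^(s+1), quasi-regularity gives f = ∑ rᵢgᵢ, which up to sign is the boundary of ∑ eᵢ ⊗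
gᵢ. -/
lemma augLin_exact {r : Fin n → R} (hr : IsRegularSeq r) (s : ℕ) :
    Function.Exact (colD r s 0) (augLin r s) := by
  intro x
  constructor
  · intro hx
    obtain ⟨f, rfl⟩ := exists_extOne_tmul x
    rw [augLin_extOne_tmul, neg_one_pow_smul_eq_zero_iff, evalForms_eq_zero_iff] at hx
    obtain ⟨g, rfl⟩ := exists_sum_smul_of_coeff_mem r f (coeff_mem_of_eval_mem hr f.2 hx)
    obtain ⟨y, hy⟩ : ∃ y, LinearMap.rTensor (Forms R n s) (koszulD r 0) y =
        extOne R n ⊗ₜ[R] ∑ i, r i • g i := by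
      refine ⟨∑ i, (exteriorPower.ιMulti R 1 fun _ => Pi.single i 1) ⊗ₜ[R] g i, ?_⟩
      rw [map_sum, TensorProduct.tmul_sum]
      refine Finset.sum_congr rfl fun i _ => ?_
      rw [LinearMap.rTensor_tmul, koszulD_zero_single, TensorProduct.smul_tmul]
    refine ⟨(-1 : R) ^ s • y, ?_⟩
    rw [colD, LinearMap.smul_apply, map_smul, neg_one_pow_smul_smul, hy]
  · rintro ⟨y, rfl⟩
    exact LinearMap.congr_fun (augLin_comp_colD r s) y

lemma augLin_surjective (r : Fin n → R) (s : ℕ) : Function.Surjective (augLin r s) := by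
  intro x
  obtain ⟨f, hf⟩ := evalForms_surjective r s ((-1 : R) ^ (s * (s + 1) / 2) • x)
  exact ⟨extOne R n ⊗ₜ f, by rw [augLin_extOne_tmul, hf, neg_one_pow_smul_smul]⟩

lemma columnAug_f_zero (r : Fin n → R) (s : ℕ) :
    (columnAug r s).f 0 = ModuleCat.ofHom (augLin r s) :=
  ChainComplex.toSingle₀Equiv_symm_apply_f_zero _ _

/-- The column `Q^s` is a resolution of `I^s/I^(s+1)`. -/
theorem quasiIso_columnAug {r : Fin n → R} (hr : IsRegularSeq r) (s : ℕ) :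
    QuasiIso (columnAug r s) where
  quasiIsoAt l := by
    cases l with
    | zero =>
      rw [ChainComplex.quasiIsoAt₀_iff, ShortComplex.quasiIso_iff_of_zeros' _ rfl rfl rfl]
      constructor
      · rw [ShortComplex.ShortExact.moduleCat_exact_iff_function_exact]
        change Function.Exact ((column r s).d 1 0).hom ((columnAug r s).f 0).hom
        rw [column_d, columnAug_f_zero]
        exact augLin_exact hr s
      · change Epi ((columnAug r s).f 0)
        rw [columnAug_f_zero]
        exact (ModuleCat.epi_iff_surjective (X := ModuleCat.of R (ExtPow R n 0 ⊗[R] Forms R n s))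
          (Y := ModuleCat.of R (PowQuot (seqIdeal r) s (s + 1))) (ModuleCat.ofHom (augLin r s))).2
          (augLin_surjective r s)
    | succ l =>
      rw [quasiIsoAt_iff_exactAt' (hL := ChainComplex.exactAt_succ_single_obj ..),
        HomologicalComplex.exactAt_iff' _ (l + 2) (l + 1) l (by simp) (by simp),
        ShortComplex.ShortExact.moduleCat_exact_iff_function_exact]
      change Function.Exact ((column r s).d (l + 2) (l + 1)).hom ((column r s).d (l + 1) l).hom
      rw [column_d, column_d]
      exact colD_exact hr s l

end ColumnExact
-- The horizontal Koszul differential as a twisting map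
section ColumnTwist

variable {R : Type u} [CommRing R] {n : ℕ}

/-- Multiplication by `xᵢ`. -/
noncomputable def mulXLin (R : Type u) [CommRing R] {n : ℕ} (s : ℕ) (i : Fin n) :
    Forms R n s →ₗ[R] Forms R n (s + 1) where
  toFun := mulX i
  map_add' _ _ := Subtype.ext (mul_add _ _ _)
  map_smul' _ _ := Subtype.ext (mul_smul_comm _ _ _)

/-- The horizontal differential `ω ⊗ f ↦ (-1)^l ∑ᵢ eᵢ^* ⌟ ω ⊗ xᵢ f` of the extended Koszul double
complex. -/
noncomputable def twistLin (R : Type u) [CommRing R] (n s l : ℕ) :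
    ExtPow R n (l + 1) ⊗[R] Forms R n s →ₗ[R] ExtPow R n l ⊗[R] Forms R n (s + 1) :=
  (-1 : R) ^ l • ∑ i : Fin n, TensorProduct.map
    (contr (LinearMap.proj i : (Fin n → R) →ₗ[R] R) l) (mulXLin R s i)

lemma twistLin_tmul (s l : ℕ) (ω : ExtPow R n (l + 1)) (f : Forms R n s) :
    twistLin R n s l (ω ⊗ₜ f) = (-1 : R) ^ l • ∑ i : Fin n,
      contr (LinearMap.proj i : (Fin n → R) →ₗ[R] R) l ω ⊗ₜ[R] mulX i f := by
  rw [twistLin, LinearMap.smul_apply, LinearMap.sum_apply]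
  rfl

lemma colD_tmul (r : Fin n → R) (s l : ℕ) (ω : ExtPow R n (l + 1)) (f : Forms R n s) :
    colD r s l (ω ⊗ₜ f) = (-1 : R) ^ s • (koszulD r l ω ⊗ₜ[R] f) := rfl

lemma contr_anticomm {M : Type*} [AddCommGroup M] [Module R M] (φ ψ : Module.Dual R M) (l : ℕ)
    (x : ⋀[R]^(l + 2) M) : contr φ l (contr ψ (l + 1) x) = (-1 : R) • contr ψ l (contr φ (l + 1) x) := by
  refine Subtype.ext ((contractExt_comm φ ψ x).trans ?_)
  rw [Submodule.coe_smul, neg_one_smul]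
  rfl

/-- Contractions anticommute, and the sign changes from `l` to `l + 1` and from `s` to `s + 1`
cancel each other. -/
lemma colD_comp_twistLin (r : Fin n → R) (s l : ℕ) :
    colD r (s + 1) l ∘ₗ twistLin R n s (l + 1) + twistLin R n s l ∘ₗ colD r s (l + 1) = 0 := by
  apply TensorProduct.ext'
  intro ω f
  rw [LinearMap.add_apply, LinearMap.comp_apply, LinearMap.comp_apply, twistLin_tmul, colD_tmul,
    map_smul, map_smul, map_sum, twistLin_tmul]
  simp only [colD_tmul]
  rw [← Finset.smul_sum, smul_smul, smul_smul]
  simp only [koszulD, contr_anticomm (∑ i, r i • (LinearMap.proj i : (Fin n → R) →ₗ[R] R)),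
    ← TensorProduct.smul_tmul', ← Finset.smul_sum, smul_smul, LinearMap.zero_apply]
  rw [← add_smul]
  have : (-1 : R) ^ (l + 1) * (-1) ^ (s + 1) * -1 + (-1) ^ s * (-1) ^ l = 0 := by ring
  rw [this, zero_smul]

/-- The map `J^s/J^(s+1) → I^s/I^(s+2)` that sends `f` to the class of `f(r₁, …, rₙ)`. -/
noncomputable def evalFormsTwo (r : Fin n → R) (s : ℕ) :
    Forms R n s →ₗ[R] PowQuot (seqIdeal r) s (s + 2) :=
  Submodule.mkQ _ ∘ₗ
    ((MvPolynomial.aeval r).toLinearMap.restrict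
      (p := MvPolynomial.homogeneousSubmodule (Fin n) R s) (q := seqIdeal r ^ s)
      fun f hf => by
        rw [AlgHom.toLinearMap_apply, MvPolynomial.aeval_eq_eval]
        exact eval_mem r hf)

lemma powQuotProj_evalFormsTwo (r : Fin n → R) (s : ℕ) (f : Forms R n s) :
    powQuotProj (seqIdeal r) s (evalFormsTwo r s f) = evalForms r s f := rfl

lemma powQuotIncl_evalForms_mulX (r : Fin n → R) (s : ℕ) (i : Fin n) (f : Forms R n s) :
    powQuotIncl (seqIdeal r) s (evalForms r (s + 1) (mulX i f)) = r i • evalFormsTwo r s f := by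
  change Submodule.Quotient.mk _ = Submodule.Quotient.mk _
  congr 1
  refine Subtype.ext ?_
  change MvPolynomial.eval r (MvPolynomial.X i * f.1) = r i * MvPolynomial.eval r f.1
  simp

/-- The lift of the augmentation `augLin` to `I^s/I^(s+2)`. -/
noncomputable def augTwoLin (r : Fin n → R) (s : ℕ) :
    ExtPow R n 0 ⊗[R] Forms R n s →ₗ[R] PowQuot (seqIdeal r) s (s + 2) :=
  (-1 : R) ^ (s * (s + 1) / 2) • (LinearMap.lsmul R (PowQuot (seqIdeal r) s (s + 2))
    |>.compl₁₂ (exteriorPower.zeroEquiv R (Fin n → R)).toLinearMap (evalFormsTwo r s)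
    |> TensorProduct.lift)

lemma augTwoLin_tmul (r : Fin n → R) (s : ℕ) (a : ExtPow R n 0) (f : Forms R n s) :
    augTwoLin r s (a ⊗ₜ f) = (-1 : R) ^ (s * (s + 1) / 2) •
      exteriorPower.zeroEquiv R (Fin n → R) a • evalFormsTwo r s f := rfl

lemma augLin_tmul (r : Fin n → R) (s : ℕ) (a : ExtPow R n 0) (f : Forms R n s) :
    augLin r s (a ⊗ₜ f) = (-1 : R) ^ (s * (s + 1) / 2) •
      exteriorPower.zeroEquiv R (Fin n → R) a • evalForms r s f := rfl

lemma powQuotProj_comp_augTwoLin (r : Fin n → R) (s : ℕ) :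
    powQuotProj (seqIdeal r) s ∘ₗ augTwoLin r s = augLin r s := by
  apply TensorProduct.ext'
  intro a f
  rw [LinearMap.comp_apply, augTwoLin_tmul, map_smul, map_smul, powQuotProj_evalFormsTwo,
    augLin_tmul]

lemma neg_one_pow_triangle_succ (s : ℕ) :
    (-1 : R) ^ ((s + 1) * (s + 1 + 1) / 2) = (-1) ^ (s * (s + 1) / 2) * (-1) ^ (s + 1) := by
  have : (s + 1) * (s + 1 + 1) = s * (s + 1) + 2 * (s + 1) := by ring
  rw [this, Nat.add_mul_div_left _ _ two_pos, pow_add]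

/-- On eᵢ ⊗ f both terms are ± rᵢ f(r). The signs are opposite since the triangular exponent grows
by s + 1, while the column contributes (-1)^s. -/
lemma augLin_comp_twistLin (r : Fin n → R) (s : ℕ) :
    powQuotIncl (seqIdeal r) s ∘ₗ augLin r (s + 1) ∘ₗ twistLin R n s 0 +
      augTwoLin r s ∘ₗ colD r s 0 = 0 := by
  apply TensorProduct.ext'
  intro ω f
  rw [LinearMap.add_apply, LinearMap.comp_apply, LinearMap.comp_apply, LinearMap.comp_apply,
    twistLin_tmul, colD_tmul, koszulD_eq, pow_zero, one_smul, map_sum, map_sum, map_smul,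
    LinearMap.sum_apply, TensorProduct.sum_tmul, map_sum, Finset.smul_sum,
    ← Finset.sum_add_distrib, LinearMap.zero_apply]
  refine Finset.sum_eq_zero fun i _ => ?_
  rw [augLin_tmul, map_smul, map_smul, powQuotIncl_evalForms_mulX, augTwoLin_tmul,
    LinearMap.smul_apply, map_smul, neg_one_pow_triangle_succ]
  simp only [smul_smul, smul_eq_mul]
  rw [← add_smul]
  convert zero_smul R _ using 2
  ring

/-- The horizontal differential as a twist of the columns `s + 1` and `s`. -/
noncomputable def columnTwist (r : Fin n → R) (s : ℕ) (h₁ : QuasiIso (columnAug r (s + 1)))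
    (h₃ : QuasiIso (columnAug r s)) :
    Twist (S := powSES (seqIdeal r) s) (columnResolution r (s + 1) h₁) (columnResolution r s h₃) where
  lam := ModuleCat.ofHom (augTwoLin r s)
  θ l := ModuleCat.ofHom (twistLin R n s l)
  lam_g := congrArg ModuleCat.ofHom (powQuotProj_comp_augTwoLin r s) |>.trans
    (columnAug_f_zero r s).symm
  comm_zero := by
    have key : ∀ (a : ModuleCat.of R (ExtPow R n 0 ⊗[R] Forms R n (s + 1)) ⟶
        ModuleCat.of R (PowQuot (seqIdeal r) (s + 1) (s + 2)))
        (d : ModuleCat.of R (ExtPow R n 1 ⊗[R] Forms R n s) ⟶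
          ModuleCat.of R (ExtPow R n 0 ⊗[R] Forms R n s)),
        a = ModuleCat.ofHom (augLin r (s + 1)) → d = ModuleCat.ofHom (colD r s 0) →
        (ModuleCat.ofHom (twistLin R n s 0) ≫ a) ≫ ModuleCat.ofHom (powQuotIncl (seqIdeal r) s) +
          d ≫ ModuleCat.ofHom (augTwoLin r s) = 0 := by
      rintro _ _ rfl rfl
      exact ModuleCat.hom_ext (augLin_comp_twistLin r s)
    exact key _ _ (columnAug_f_zero r (s + 1)) (column_d r s 0)
  comm_succ l := by
    have e1 : (columnResolution r (s + 1) h₁).complex.d (l + 1) l = _ := column_d r (s + 1) l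
    have e2 : (columnResolution r s h₃).complex.d (l + 2) (l + 1) = _ := column_d r s (l + 1)
    rw [e1, e2]
    exact ModuleCat.hom_ext (colD_comp_twistLin r s l)

/-- The functor `R/I ⊗ -`. -/
noncomputable abbrev tensorQuot (I : Ideal R) : ModuleCat.{u} R ⥤ ModuleCat.{u} R :=
  (MonoidalCategory.tensoringLeft (ModuleCat.{u} R)).obj (ModuleCat.of R (R ⧸ I))

/-- Every element is a cycle, so the identification is the identity lifted to cycles followed by the
projection to homology: the form in which the snake chase delivers its result. -/
lemma tensorColumnHomologyIso_hom (r : Fin n → R) (s l k : ℕ)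
    (hk : (ComplexShape.down ℕ).next l = k)
    (h : 𝟙 _ ≫ (((tensorQuot (seqIdeal r)).mapHomologicalComplex (ComplexShape.down ℕ)).obj
      (column r s)).d l k = 0) :
    (tensorColumnHomologyIso r s l).hom =
      (((tensorQuot (seqIdeal r)).mapHomologicalComplex (ComplexShape.down ℕ)).obj
        (column r s)).liftCycles (𝟙 _) k hk h ≫
      (((tensorQuot (seqIdeal r)).mapHomologicalComplex (ComplexShape.down ℕ)).obj
        (column r s)).homologyπ l := by
  subst hk
  set K := ((tensorQuot (seqIdeal r)).mapHomologicalComplex (ComplexShape.down ℕ)).obj (column r s)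
  let D : (K.sc l).LeftHomologyData := ShortComplex.LeftHomologyData.ofZeros (K.sc l)
    (tensor_column_d r s _ _) (tensor_column_d r s _ _)
  change D.homologyIso.inv = _
  have h1 : D.cyclesIso.inv = K.liftCycles (𝟙 _) _ rfl h := by
    refine (cancel_mono (K.iCycles l)).1 ?_
    exact D.cyclesIso_inv_comp_iCycles.trans (K.liftCycles_i _ _ _ _).symm
  have h2 := D.π_comp_homologyIso_inv
  rw [h1] at h2
  exact (Category.id_comp _).symm.trans h2

end ColumnTwist
-- The connecting homomorphism on Tor
section Connecting

variable {R : Type u} [CommRing R] {n : ℕ}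

/-- The complex `R/I ⊗ Q^s`. -/
noncomputable abbrev tensorColumn (r : Fin n → R) (s : ℕ) : ChainComplex (ModuleCat.{u} R) ℕ :=
  ((tensorQuot (seqIdeal r)).mapHomologicalComplex (ComplexShape.down ℕ)).obj (column r s)

/-- The horizontal differential after tensoring with `R/I`. -/
noncomputable def tensorTwist (r : Fin n → R) (s l : ℕ) :
    ModuleCat.of R ((R ⧸ seqIdeal r) ⊗[R] (ExtPow R n (l + 1) ⊗[R] Forms R n s)) ⟶
      ModuleCat.of R ((R ⧸ seqIdeal r) ⊗[R] (ExtPow R n l ⊗[R] Forms R n (s + 1))) :=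
  ModuleCat.ofHom (LinearMap.lTensor (R ⧸ seqIdeal r) (twistLin R n s l))

/-- The connecting homomorphism of the short exact sequence of resolutions `Q^(s+1)`, `Q^s`,
tensored with `R/I`. -/
noncomputable def columnδ (r : Fin n → R) (s l : ℕ)
    (h₁ : QuasiIso (columnAug r (s + 1))) (h₃ : QuasiIso (columnAug r s)) :
    (tensorColumn r s).homology (l + 1) ⟶ (tensorColumn r (s + 1)).homology l :=
  (((columnTwist r s h₁ h₃).resolutionSES (powSES_shortExact (seqIdeal r) s)).shortExact_map
    (tensorQuot (seqIdeal r))).δ (l + 1) l rfl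

lemma tensorColumnHomologyIso_hom_δ (r : Fin n → R) (s l : ℕ)
    (h₁ : QuasiIso (columnAug r (s + 1))) (h₃ : QuasiIso (columnAug r s)) :
    (tensorColumnHomologyIso r s (l + 1)).hom ≫
      columnδ r s l h₁ h₃ =
    tensorTwist r s l ≫ (tensorColumnHomologyIso r (s + 1) l).hom := by
  let K := tensorColumn r (s + 1)
  have e₃ : 𝟙 _ ≫ (tensorColumn r s).d (l + 1) l = 0 := by rw [tensor_column_d, comp_zero]
  have e₁ : 𝟙 _ ≫ K.d l ((ComplexShape.down ℕ).next l) = 0 := by rw [tensor_column_d, comp_zero]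
  have e₁' : (show _ ⟶ K.X l from tensorTwist r s l) ≫
      K.d l ((ComplexShape.down ℕ).next l) = 0 := by rw [tensor_column_d, comp_zero]
  have key := (columnTwist r s h₁ h₃).liftCycles_δ (powSES_shortExact (seqIdeal r) s)
    (tensorQuot (seqIdeal r)) l e₃ e₁'
  -- Lifting to cycles commutes with precomposition, so `tensorTwist` can be pulled out in front of
  -- the universal cycle.
  have hc : K.liftCycles (show _ ⟶ K.X l from tensorTwist r s l) _ rfl e₁' =
      tensorTwist r s l ≫ K.liftCycles (𝟙 _) _ rfl e₁ := by
    refine (cancel_mono (K.iCycles l)).1 ?_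
    refine (K.liftCycles_i _ _ _ _).trans (Eq.trans ?_ (Category.assoc _ _ _).symm)
    exact (Category.comp_id _).symm.trans (congrArg _ (K.liftCycles_i _ _ _ _).symm)
  rw [tensorColumnHomologyIso_hom r s (l + 1) l (ChainComplex.next_nat_succ l) e₃,
    tensorColumnHomologyIso_hom r (s + 1) l _ rfl e₁]
  exact (Category.assoc _ _ _).trans (key.trans ((congrArg (· ≫ K.homologyπ l) hc).trans
    (Category.assoc _ _ _)))

/-- In terms of the Koszul resolutions the connecting homomorphism is the horizontal differential
of the extended Koszul double complex. -/
lemma torδ_torIso (r : Fin n → R) (s l : ℕ) (h₁ : QuasiIso (columnAug r (s + 1)))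
    (h₃ : QuasiIso (columnAug r s))
    (x : (R ⧸ seqIdeal r) ⊗[R] (ExtPow R n (l + 1) ⊗[R] Forms R n s)) :
    torδ (seqIdeal r) s l (torIso r s (l + 1) h₃ x) =
      torIso r (s + 1) l h₁ (LinearMap.lTensor (R ⧸ seqIdeal r) (twistLin R n s l) x) := by
  let F := tensorQuot (seqIdeal r)
  let iso₃ : TorPow (seqIdeal r) s (s + 1) (l + 1) ≅ (tensorColumn r s).homology (l + 1) :=
    (columnResolution r s h₃).isoLeftDerivedObj F (l + 1)
  let iso₁ : TorPow (seqIdeal r) (s + 1) (s + 2) l ≅ (tensorColumn r (s + 1)).homology l :=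
    (columnResolution r (s + 1) h₁).isoLeftDerivedObj F l
  let d : TorPow (seqIdeal r) s (s + 1) (l + 1) ⟶ TorPow (seqIdeal r) (s + 1) (s + 2) l :=
    leftDerivedδ F (powSES_shortExact (seqIdeal r) s) l
  have hd : d = iso₃.hom ≫ columnδ r s l h₁ h₃ ≫ iso₁.inv :=
    leftDerivedδ_eq F _ ((columnTwist r s h₁ h₃).resolutionSES (powSES_shortExact _ s)) l
  have key : ((tensorColumnHomologyIso r s (l + 1)).hom ≫ iso₃.inv) ≫ d =
      tensorTwist r s l ≫ (tensorColumnHomologyIso r (s + 1) l).hom ≫ iso₁.inv := by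
    rw [hd, Category.assoc, Iso.inv_hom_id_assoc, ← Category.assoc,
      tensorColumnHomologyIso_hom_δ, Category.assoc]
  exact congrArg (fun g => g.hom x) key

/-- Contraction with the coordinate k meets only the positions j with i_j = k, which collapses the
sum over variables. The sign (-1)^l (-1)^j, with j counted from zero, equals (-1)^((j+1)+(l+1)). -/
lemma lTensor_twistLin_wedgeForm (r : Fin n → R) {s l : ℕ} (i : Fin (l + 1) → Fin n)
    (f : Forms R n s) :
    LinearMap.lTensor (R ⧸ seqIdeal r) (twistLin R n s l) (wedgeForm r i f) =
      ∑ j : Fin (l + 1), (-1 : R) ^ (((j : ℕ) + 1) + (l + 1)) •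
        wedgeForm r (i ∘ j.succAbove) (mulX (i j) f) := by
  have h : twistLin R n s l (exteriorPower.ιMulti R (l + 1)
      (fun a => (Pi.single (i a) 1 : Fin n → R)) ⊗ₜ[R] f) =
      ∑ j : Fin (l + 1), (-1 : R) ^ (((j : ℕ) + 1) + (l + 1)) •
        (exteriorPower.ιMulti R l (fun a => (Pi.single ((i ∘ j.succAbove) a) 1 : Fin n → R)) ⊗ₜ[R]
          mulX (i j) f) := by
    rw [twistLin_tmul]
    simp only [contr_ιMulti, TensorProduct.sum_tmul]
    rw [Finset.sum_comm, Finset.smul_sum]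
    refine Finset.sum_congr rfl fun j _ => ?_
    rw [Finset.sum_eq_single (i j)]
    · rw [LinearMap.proj_apply, Pi.single_eq_same, mul_one, ← TensorProduct.smul_tmul', smul_smul]
      congr 1
      ring
    · intro k _ hk
      rw [LinearMap.proj_apply, Pi.single_eq_of_ne hk, mul_zero, zero_smul, TensorProduct.zero_tmul]
    · simp
  rw [wedgeForm, LinearMap.lTensor_tmul, h, TensorProduct.tmul_sum]
  refine Finset.sum_congr rfl fun j _ => ?_
  rw [TensorProduct.tmul_smul, wedgeForm]

end Connecting
end KoszulTor

/-- `∂(e_{i₁} ∧ … ∧ e_{iₗ₊₁} ⊗ f) = ∑ⱼ (-1)^(j+(l+1)) e_{i₁} ∧ … ê_{iⱼ} … ∧ e_{iₗ₊₁} ⊗ x_{iⱼ} f`; the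
index `j : Fin (l + 1)` below starts at zero. -/
theorem mainTheorem4 {R : Type u} [CommRing R] {n : ℕ} (r : Fin n → R)
    (hr : RingTheory.Sequence.IsRegular R (List.ofFn r)) :
    ∃ hq : ∀ s : ℕ, QuasiIso (KoszulTor.columnAug r s),
      ∀ (s l : ℕ) (i : Fin (l + 1) → Fin n) (m : Fin n →₀ ℕ) (hm : m.degree = s),
        KoszulTor.torδ (KoszulTor.seqIdeal r) s l
            (KoszulTor.torIso r s (l + 1) (hq s)
              (KoszulTor.wedgeForm r i (KoszulTor.monomialForm R m hm))) =
          ∑ j : Fin (l + 1), (-1 : R) ^ (((j : ℕ) + 1) + (l + 1)) •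
            KoszulTor.torIso r (s + 1) l (hq (s + 1))
              (KoszulTor.wedgeForm r (i ∘ j.succAbove)
                (KoszulTor.mulX (i j) (KoszulTor.monomialForm R m hm))) := by
  have hreg := KoszulTor.isRegularSeq_of_isWeaklyRegular hr.toIsWeaklyRegular
  refine ⟨KoszulTor.quasiIso_columnAug hreg, fun s l i m hm => ?_⟩
  rw [KoszulTor.torδ_torIso r s l (KoszulTor.quasiIso_columnAug hreg (s + 1)),
    KoszulTor.lTensor_twistLin_wedgeForm, map_sum]
  simp only [map_smul]
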